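/- **Setting.** Fix $K\in\mathbb Z_+$, a constant $C>0$ and a design matrix $Q=(q_{jk})\in\{0,1\}^{\mathbb Z_+\times\{1,\dots,K\}}$. For $S\subset\{1,\dots,K\}$ let $R_Q(S)=\{j: q_{jk}=1 \text{ for all } k\in S,\ q_{jk}=0\text{ for all }k\notin S\}$. *Model.* Fix a dominating measure on $\mathbb R$, a known scale $\phi>0$ and a measurable function $c(\cdot,\phi)$. For $\Theta,A\in\mathbb R^{\mathbb Z_+\times\{1,\dots,K\}}$ with rows $\theta_i$, $a_j$, let $P_{\Theta,A}$ be the law of the array $(Y_{ij})_{i,j\ge1}$ of independent variables in which $Y_{ij}$ has density $\exp\{(y\,m_{ij}-b(m_{ij}))/\phi+c(y,\phi)\}$ with $m_{ij}=a_j^\top\theta_i$, where $b$ (possibly infinite) is the normalizing function. *Notation.* $W_{[1:m,1:n]}$ is the upper left block of $W$; $\|\cdot\|$ and $\|\cdot\|_F$ are the Euclidean and the Frobenius norm; $N\wedge J=\min(N,J)$. For a matrix $W$ with infinitely many rows and $n$ columns, $\gamma(W)=\liminf_{m\to\infty}\sigma_n(W_{[1:m,1:n]})/\sqrt m$, where $\sigma_n$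 is the $n$-th largest singular value. For $u,v\in\mathbb R^N$, $\sin\angle(u,v)=\sqrt{1-(u^\top v)^2/(\|u\|^2\|v\|^2)}$ if $u,v\ne0$; for an estimate equal to $0$ we put $\sin\angle(0,v)=1$. $A_{[R,S]}$ is the submatrix of $A$ with rows in $R$ (in increasing order) and columns in $S$. *Assumptions.* (A1) For every $S\subset\{1,\dots,K\}$ the limit $p_Q(S)=\lim_{J\to\infty}|R_Q(S)\cap\{1,\dots,J\}|/J$ exists, and $p_Q(\emptyset)=0$. (A2) $\{\nu:|b(\nu)|<\infty\}=\mathbb R$. *Parameter space.* $\mathcal S_Q=\mathcal S_Q^{(1)}\times\mathcal S_Q^{(2)}$, where $$\mathcal S_Q^{(1)}=\{\Theta:\ \|\theta_i\|\le C\text{ for all }i,\ \gamma(\Theta)>0\},$$ $$\mathcal S_Q^{(2)}=\{A:\ \|a_j\|\le C\text{ for all }j;\ A_{[R_Q(S),S^c]}=0\text{ for all }S;\ \gamma(A_{[R_Q(S),S]})>0\text{ for all }S\text{ with }p_Q(S)>0\}.$$ **Theorem.** Suppose that (A1) and (A2) hold. 1. There exist $\varepsilon_1>0$ and $N_0,J_0>0$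 such that for all $N\ge N_0$, $J\ge J_0$ and every estimator $\bar M^{(N,J)}$, that is, every measurable map of the data $Y_{[1:N,1:J]}$ to $\mathbb R^{N\times J}$, there exists $(\Theta^*,A^*)\in\mathcal S_Q$ with $$P_{\Theta^*,A^*}\left(\frac1{\sqrt{NJ}}\left\|\bar M^{(N,J)}-\Theta^*_{[1:N,1:K]}(A^*_{[1:J,1:K]})^\top\right\|_F\ge\frac{\varepsilon_1}{\sqrt{N\wedge J}}\right)\ge\frac12 .$$ 2. For each $k\in\{1,\dots,K\}$ and each $A^*\in\mathcal S_Q^{(2)}$ there exist $\varepsilon_2>0$ and $N_0,J_0>0$ such that for all $N\ge N_0$, $J\ge J_0$ and every estimator $\bar\Theta^{(N,J)}_{[k]}$, that is, every measurable map of $Y_{[1:N,1:J]}$ to $\mathbb R^N$, there exists $\Theta^*\in\mathcal S_Q^{(1)}$ with $\Theta^*_{[1:N,k]}\ne0$ and $$P_{\Theta^*,A^*}\left(\sin\angle\left(\bar\Theta^{(N,J)}_{[k]},\Theta^*_{[1:N,k]}\right)\ge\frac{\varepsilon_2}{\sqrt J}\right)\ge\frac12 .$$ -/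

import Mathlib

open MeasureTheory Filter Topology
open scoped ENNReal

noncomputable section

namespace LatentFactor

/-! ### The exponential family and the generalized latent factor model -/

/-- A one-parameter exponential family with known scale parameter `φ > 0`: with respect to the
dominating measure `ref` (for instance Lebesgue measure, or counting measure on a discrete set),
the density at natural parameter `m` is `y ↦ exp ((y * m - b m) / φ + c y φ)`, where `b` is the
normalizing function `ExpFamily.b` below. -/
structure ExpFamily where
  ref : Measure ℝ
  φ : ℝ
  φ_pos : 0 < φ
  c : ℝ → ℝ → ℝ
  measurable_c : Measurable fun y => c y φ

namespace ExpFamily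

variable (F : ExpFamily)

/-- The normalizing integral `∫ exp (y m / φ + c(y, φ)) d ref(y)`, possibly infinite. -/
def Z (m : ℝ) : ℝ≥0∞ :=
  ∫⁻ y, ENNReal.ofReal (Real.exp (y * m / F.φ + F.c y F.φ)) ∂F.ref

/-- The function `b`, with values in the extended reals: the value that makes
`exp ((y m - b m) / φ + c(y, φ))` integrate to one. -/
def b (m : ℝ) : EReal := (F.φ : EReal) * ENNReal.log (F.Z m)

/-- The natural parameter space `{ν : |b ν| < ∞}` is the whole real line. -/
def FullNaturalSpace : Prop := {ν : ℝ | (F.b ν).abs < ⊤} = Set.univ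

/-- The distribution of an observation with natural parameter `m`. -/
def law (m : ℝ) : Measure ℝ :=
  F.ref.withDensity fun y =>
    ENNReal.ofReal (Real.exp ((y * m - (F.b m).toReal) / F.φ + F.c y F.φ))

variable {F}

theorem isProbabilityMeasure_law (h : F.FullNaturalSpace) (m : ℝ) :
    IsProbabilityMeasure (F.law m) := by
  have hφ := F.φ_pos
  have hm : (F.b m).abs < ⊤ := by
    have : m ∈ {ν : ℝ | (F.b ν).abs < ⊤} := by rw [h]; trivial
    exact this
  have h0 : F.Z m ≠ 0 := by
    intro h0
    rw [b, h0, ENNReal.log_zero, EReal.coe_mul_bot_of_pos hφ] at hm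
    simp at hm
  have ht : F.Z m ≠ ⊤ := by
    intro h0
    rw [b, h0, ENNReal.log_top, EReal.coe_mul_top_of_pos hφ] at hm
    simp at hm
  have hb : (F.b m).toReal = F.φ * Real.log (F.Z m).toReal := by
    rw [b, ENNReal.log_pos_real h0 ht, ← EReal.coe_mul, EReal.toReal_coe]
  have hpos : 0 < (F.Z m).toReal := ENNReal.toReal_pos h0 ht
  have hd : ∀ y : ℝ, ENNReal.ofReal (Real.exp ((y * m - (F.b m).toReal) / F.φ + F.c y F.φ))
      = (F.Z m)⁻¹ * ENNReal.ofReal (Real.exp (y * m / F.φ + F.c y F.φ)) := by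
    intro y
    have h1 : (y * m - (F.b m).toReal) / F.φ + F.c y F.φ
        = -Real.log (F.Z m).toReal + (y * m / F.φ + F.c y F.φ) := by
      rw [hb]; field_simp; ring
    rw [h1, Real.exp_add, Real.exp_neg, Real.exp_log hpos,
      ENNReal.ofReal_mul (inv_nonneg.2 hpos.le), ENNReal.ofReal_inv_of_pos hpos,
      ENNReal.ofReal_toReal ht]
  constructor
  rw [law, withDensity_apply _ MeasurableSet.univ, Measure.restrict_univ]
  simp_rw [hd]
  rw [lintegral_const_mul' _ _ (ENNReal.inv_ne_top.2 h0)]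
  exact ENNReal.inv_mul_cancel h0 ht

/-- The distribution `P_{Θ,A}` of the infinite data array `(Y (i, j))`: the entries are
independent and `Y (i, j)` has natural parameter `m_{ij} = a_jᵀ θ_i`. -/
def dataLaw (h : F.FullNaturalSpace) {K : ℕ} (Θ A : Matrix ℕ (Fin K) ℝ) :
    Measure (ℕ × ℕ → ℝ) :=
  haveI : ∀ p : ℕ × ℕ, IsProbabilityMeasure (F.law (A p.2 ⬝ᵥ Θ p.1)) :=
    fun _ => isProbabilityMeasure_law h _
  Measure.infinitePi fun p : ℕ × ℕ => F.law (A p.2 ⬝ᵥ Θ p.1)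

end ExpFamily

/-- The observed block `Y_{[1:N,1:J]}`. -/
def dataBlock (N J : ℕ) (Y : ℕ × ℕ → ℝ) : Fin N → Fin J → ℝ := fun i j => Y (i, j)

/-! ### Matrices -/

/-- The first `m` rows of a matrix with countably many rows. -/
def firstRows {ι : Type*} (m : ℕ) (W : Matrix ℕ ι ℝ) : Matrix (Fin m) ι ℝ :=
  W.submatrix (fun i : Fin m => (i : ℕ)) id

/-- The Frobenius norm. -/
def frobNorm {m n : ℕ} (W : Matrix (Fin m) (Fin n) ℝ) : ℝ := √(∑ i, ∑ j, W i j ^ 2)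

/-- The `n`-th (smallest) singular value `σ_n` of a matrix with `n` columns
(Mathlib numbers the singular values from `0`, in descending order). -/
def sigmaMin {ι : Type*} [Fintype ι] [DecidableEq ι] {m : ℕ} (W : Matrix (Fin m) ι ℝ) : ℝ :=
  (Matrix.toEuclideanLin W).singularValues (Fintype.card ι - 1)

/-- `γ(W) = liminf_m σ_n(W_{[1:m,1:n]}) / √m`, taken in the extended reals. -/
def gam {ι : Type*} [Fintype ι] [DecidableEq ι] (W : Matrix ℕ ι ℝ) : EReal :=
  liminf (fun m : ℕ => ((sigmaMin (firstRows m W) / √(m : ℝ) : ℝ) : EReal)) atTop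

/-- `sin ∠(u, v) = √(1 - (uᵀ v)² / (‖u‖² ‖v‖²))`; it equals `1` if `u` or `v` is zero. -/
def sinAngle {n : ℕ} (u v : Fin n → ℝ) : ℝ :=
  √(1 - (u ⬝ᵥ v) ^ 2 / ((u ⬝ᵥ u) * (v ⬝ᵥ v)))

/-! ### The design matrix and the parameter space -/

variable {K : ℕ}

/-- `R_Q(S)`: the manifest variables associated with and only with the factors in `S`. -/
def RQ (Q : ℕ → Fin K → Bool) (S : Finset (Fin K)) : Set ℕ :=
  {j | (∀ k ∈ S, Q j k = true) ∧ ∀ k, k ∉ S → Q j k = false}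

instance (Q : ℕ → Fin K → Bool) (S : Finset (Fin K)) : DecidablePred (· ∈ RQ Q S) :=
  fun j => inferInstanceAs
    (Decidable ((∀ k ∈ S, Q j k = true) ∧ ∀ k, k ∉ S → Q j k = false))

/-- The proportion of the first `J` manifest variables that lie in `R_Q(S)`. -/
def freq (Q : ℕ → Fin K → Bool) (S : Finset (Fin K)) (J : ℕ) : ℝ :=
  (Nat.count (· ∈ RQ Q S) J : ℝ) / J

/-- The limiting proportion `p_Q(S)`. -/
def pQ (Q : ℕ → Fin K → Bool) (S : Finset (Fin K)) : ℝ := limUnder atTop (freq Q S)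

/-- All limiting proportions exist, and `p_Q(∅) = 0`. -/
def StableDesign (Q : ℕ → Fin K → Bool) : Prop :=
  (∀ S, ∃ p : ℝ, Tendsto (freq Q S) atTop (𝓝 p)) ∧ pQ Q ∅ = 0

/-- The submatrix `A_{[R_Q(S),S]}`, its rows listed in increasing order
(used only when `R_Q(S)` is infinite). -/
def subLoading (Q : ℕ → Fin K → Bool) (S : Finset (Fin K)) (A : Matrix ℕ (Fin K) ℝ) :
    Matrix ℕ S ℝ :=
  A.submatrix (Nat.nth (· ∈ RQ Q S)) (fun k : S => (k : Fin K))

/-- The parameter space `S_Q^{(1)}` of the factor scores. -/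
def SQ1 (K : ℕ) (C : ℝ) : Set (Matrix ℕ (Fin K) ℝ) :=
  {Θ | (∀ i, ‖WithLp.toLp 2 (Θ i)‖ ≤ C) ∧ 0 < gam Θ}

/-- The parameter space `S_Q^{(2)}` of the loadings. -/
def SQ2 (Q : ℕ → Fin K → Bool) (C : ℝ) : Set (Matrix ℕ (Fin K) ℝ) :=
  {A | (∀ j, ‖WithLp.toLp 2 (A j)‖ ≤ C) ∧
    (∀ S : Finset (Fin K), ∀ j ∈ RQ Q S, ∀ k, k ∉ S → A j k = 0) ∧
    ∀ S : Finset (Fin K), 0 < pQ Q S → 0 < gam (subLoading Q S A)}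

/-- The parameter space `S_Q = S_Q^{(1)} × S_Q^{(2)}`. -/
def SQ (Q : ℕ → Fin K → Bool) (C : ℝ) :
    Set (Matrix ℕ (Fin K) ℝ × Matrix ℕ (Fin K) ℝ) :=
  SQ1 K C ×ˢ SQ2 Q C

end LatentFactor

end

noncomputable section

namespace LatentFactor

/-! Both bounds follow an Assouad-type argument with a four-letter alphabet. A hypercube of
parameters, indexed by `v` with values in `Fin 4`, is built on a single factor `k`: the varying
entries are `C / 2 + δ * v i`. If each coordinate enters `m` observations, `δ = κ / √m` keeps the
effect of changing one coordinate bounded: the squared change of all natural parameters is at most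
`9 * C ^ 2 * κ ^ 2`. For an exponential family with finite `b`, the second moment of the likelihood
ratio is at most `exp (B * ‖change‖ ^ 2)` on bounded parameters (`exists_blockLaw_le_add`), so a
small `κ`, independent of `N` and `J`, makes event probabilities move by at most 1/8
(`exists_perturbation_scale`).

Any decoder then identifies a coordinate with average probability at most 1/4 + 1/8 = 3/8. If an
estimator were accurate with probability above 1/2 at every `v`, decoding to any `v` for which its
output is accurate would recover 7/8 of the coordinates on that event, hence an average fraction
above 7/16 > 3/8. This contradiction is `exists_half_le_failure`. Two letters would not do, since
blind guessing already scores 1/2.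

For the matrix bound, the longer side varies: the scores if `J ≤ N`, otherwise the loadings on `k`,
where `k` is used by a positive fraction of the items. For the angle bound only the scores vary, and
half of them stay at `C / 2` to remove the scale ambiguity of an angle.

The conditions on `γ` are asymptotic and cost nothing: rows outside the observed block cycle through
multiples of basis vectors. -/

/-! ### Positivity of `γ` for cyclic rows -/

theorem sqrt_le_sigmaMin {ι : Type*} [Fintype ι] [DecidableEq ι] [Nonempty ι] {m : ℕ}
    (W : Matrix (Fin m) ι ℝ) {c : ℝ}
    (h : ∀ x : ι → ℝ, c * ∑ k, x k ^ 2 ≤ ∑ i, (W i ⬝ᵥ x) ^ 2) : √c ≤ sigmaMin W := by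
  set T := Matrix.toEuclideanLin W
  have hlt : Fintype.card ι - 1 < Module.finrank ℝ (EuclideanSpace ℝ ι) := by
    have := Fintype.card_pos (α := ι)
    rw [finrank_euclideanSpace]; omega
  -- The assumed bound on the quadratic form is tested at an eigenvector of `T* T` whose eigenvalue
  -- is the squared smallest singular value.
  obtain ⟨v, hv⟩ := (T.hasEigenvalue_adjoint_comp_self_sq_singularValues hlt).exists_hasEigenvector
  have hv0 : v ≠ 0 := hv.2
  have h1 : ‖T v‖ ^ 2 = sigmaMin W ^ 2 * ‖v‖ ^ 2 := by
    have h2 : (LinearMap.adjoint T ∘ₗ T) v = (sigmaMin W ^ 2) • v := hv.apply_eq_smul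
    have h3 : inner ℝ ((LinearMap.adjoint T) (T v)) v = inner ℝ (T v) (T v) :=
      LinearMap.adjoint_inner_left T v (T v)
    rw [← real_inner_self_eq_norm_sq, ← h3]
    have h4 : (LinearMap.adjoint T) (T v) = (sigmaMin W ^ 2) • v := h2
    rw [h4, real_inner_smul_left, real_inner_self_eq_norm_sq]
  have h5 := h v
  have h6 : ∑ i, (W i ⬝ᵥ v) ^ 2 = ‖T v‖ ^ 2 := by
    rw [EuclideanSpace.norm_sq_eq]
    refine Finset.sum_congr rfl fun i _ => ?_
    rw [Real.norm_eq_abs, sq_abs]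
    rfl
  have h7 : ∑ k, v k ^ 2 = ‖v‖ ^ 2 := by
    rw [EuclideanSpace.norm_sq_eq]
    simp
  rw [h6, h7, h1] at h5
  have hpos : 0 < ‖v‖ ^ 2 := by positivity
  exact Real.sqrt_le_iff.2 ⟨LinearMap.singularValues_nonneg _ _, le_of_mul_le_mul_right h5 hpos⟩

/-- The `n`-th element, counted cyclically, of a nonempty finite type. -/
def cyc (ι : Type*) [Fintype ι] [Nonempty ι] (n : ℕ) : ι :=
  (Fintype.equivFin ι).symm ⟨n % Fintype.card ι, Nat.mod_lt _ Fintype.card_pos⟩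

theorem card_cyc_eq_ge {ι : Type*} [Fintype ι] [DecidableEq ι] [Nonempty ι] (n₀ m : ℕ) (k : ι) :
    m / Fintype.card ι - n₀ ≤
      (((Finset.range m).filter fun n => n₀ ≤ n).filter fun n => cyc ι n = k).card := by
  set d := Fintype.card ι
  have hd : 0 < d := Fintype.card_pos
  have hr := (Fintype.equivFin ι k).isLt
  rw [← Nat.card_Ico]
  refine Finset.card_le_card_of_injOn (fun q => d * q + (Fintype.equivFin ι k : ℕ)) ?_ ?_
  · intro q hq
    simp only [Finset.coe_Ico, Set.mem_Ico] at hq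
    have h1 : d * (q + 1) ≤ m := (Nat.mul_le_mul_left d hq.2).trans (Nat.mul_div_le m d)
    have h2 : q ≤ d * q := Nat.le_mul_of_pos_left q hd
    simp only [Finset.coe_filter, Finset.mem_filter, Finset.mem_range, Set.mem_ofPred_eq]
    refine ⟨⟨by rw [mul_add] at h1; omega, by omega⟩, ?_⟩
    rw [cyc, Equiv.symm_apply_eq]
    ext
    exact (Nat.mul_add_mod _ _ _).trans (Nat.mod_eq_of_lt hr)
  · intro q _ q' _ h
    simpa [hd.ne'] using h

/-- The rows from `n₀` on make the Gram form of the first `m` rows dominate a diagonal form. Each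
basis vector occurs at least `m / d - 1 - n₀` times, which is at least `m / (2 * d)` once `m ≥ 2 * d
* (1 + n₀)`. -/
theorem gam_pos_of_eventually_cyc {ι : Type*} [Fintype ι] [DecidableEq ι] [Nonempty ι]
    (W : Matrix ℕ ι ℝ) {C : ℝ} (hC : 0 < C) (n₀ : ℕ)
    (h : ∀ n, n₀ ≤ n → W n = Pi.single (cyc ι n) C) : 0 < gam W := by
  set d := Fintype.card ι
  have hd : 0 < d := Fintype.card_pos
  have hd' : (0 : ℝ) < d := by exact_mod_cast hd
  have key : ∀ m, 2 * d * (1 + n₀) ≤ m → √(C ^ 2 / (2 * d)) * √m ≤ sigmaMin (firstRows m W) := by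
    intro m hm
    rw [← Real.sqrt_mul (by positivity)]
    refine sqrt_le_sigmaMin _ fun x => ?_
    have h1 : ∑ i : Fin m, (firstRows m W i ⬝ᵥ x) ^ 2 = ∑ n ∈ Finset.range m, (W n ⬝ᵥ x) ^ 2 :=
      Fin.sum_univ_eq_sum_range (fun n => (W n ⬝ᵥ x) ^ 2) m
    have h2 : ∑ n ∈ (Finset.range m).filter (fun n => n₀ ≤ n), (W n ⬝ᵥ x) ^ 2
        ≤ ∑ n ∈ Finset.range m, (W n ⬝ᵥ x) ^ 2 :=
      Finset.sum_le_sum_of_subset_of_nonneg (Finset.filter_subset _ _)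
        fun _ _ _ => sq_nonneg _
    rw [h1]
    refine le_trans ?_ h2
    rw [← Finset.sum_fiberwise _ (cyc ι), Finset.mul_sum]
    refine Finset.sum_le_sum fun k _ => ?_
    have h3 : ∑ n ∈ ((Finset.range m).filter fun n => n₀ ≤ n).filter (fun n => cyc ι n = k),
        (W n ⬝ᵥ x) ^ 2 =
        ∑ n ∈ ((Finset.range m).filter fun n => n₀ ≤ n).filter (fun n => cyc ι n = k),
          (C * x k) ^ 2 := by
      refine Finset.sum_congr rfl fun n hn => ?_
      simp only [Finset.mem_filter] at hn
      rw [h n hn.1.2, hn.2, single_dotProduct]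
    rw [h3, Finset.sum_const, nsmul_eq_mul]
    have h4 : (m : ℝ) / (2 * d) ≤
        ((((Finset.range m).filter fun n => n₀ ≤ n).filter fun n => cyc ι n = k).card : ℝ) := by
      have h5 : ((m / d : ℕ) : ℝ) ≤
        ((((Finset.range m).filter fun n => n₀ ≤ n).filter fun n => cyc ι n = k).card : ℝ) + n₀ := by
        have := card_cyc_eq_ge n₀ m k
        exact_mod_cast Nat.sub_le_iff_le_add.1 this
      have h6 : (m : ℝ) / d < (m / d : ℕ) + 1 := by
        rw [div_lt_iff₀ hd']
        have := Nat.lt_mul_div_succ m hd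
        rw [mul_comm]
        exact_mod_cast this
      have h7 : (1 + n₀ : ℝ) ≤ m / (2 * d) := by
        rw [le_div_iff₀ (by positivity), mul_comm]
        exact_mod_cast hm
      have h8 : (m : ℝ) / d = m / (2 * d) + m / (2 * d) := by field_simp; ring
      linarith
    calc C ^ 2 / (2 * d) * m * x k ^ 2 = m / (2 * d) * (C * x k) ^ 2 := by ring
      _ ≤ _ := mul_le_mul_of_nonneg_right h4 (sq_nonneg _)
  have hpos : (0 : ℝ) < √(C ^ 2 / (2 * d)) := Real.sqrt_pos.2 (by positivity)
  refine lt_of_lt_of_le (EReal.coe_pos.2 hpos) (le_liminf_of_le (by isBoundedDefault) ?_)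
  filter_upwards [eventually_ge_atTop (2 * d * (1 + n₀)), eventually_gt_atTop 0] with m hm hm0
  have : (0 : ℝ) < √m := Real.sqrt_pos.2 (by exact_mod_cast hm0)
  exact EReal.coe_le_coe ((le_div_iff₀ this).2 (key m hm))

/-! ### Second differences and likelihood ratios -/

/-- Subtracting `|B| / 2 * x ^ 2`, where `B` bounds the second derivative, leaves a concave
function; its midpoint inequality at `x` and `2 * y - x` is the claim. -/
theorem exists_second_difference_le {f : ℝ → ℝ} (hf : ContDiff ℝ 2 f) (R : ℝ) :
    ∃ B : ℝ, 0 ≤ B ∧ ∀ x y, |x| ≤ R → |2 * y - x| ≤ R →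
      f (2 * y - x) + f x - 2 * f y ≤ B * (y - x) ^ 2 := by
  have hf1 : ContDiff ℝ 1 (deriv f) := by
    have := (contDiff_succ_iff_deriv (n := 1) (f := f)).1 (by exact_mod_cast hf)
    exact this.2.2
  have hf2 : Continuous (deriv (deriv f)) := hf1.continuous_deriv le_rfl
  obtain ⟨B, hB⟩ := (isCompact_Icc (a := -R) (b := R)).exists_bound_of_continuousOn
    hf2.continuousOn
  have hd : Differentiable ℝ f := hf.differentiable (by norm_num)
  have hd1 : Differentiable ℝ (deriv f) := hf1.differentiable (by norm_num)
  have hg' : deriv (fun x => f x - |B| / 2 * x ^ 2) = fun x => deriv f x - |B| * x := by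
    funext x
    have : HasDerivAt (fun x => f x - |B| / 2 * x ^ 2) (deriv f x - |B| / 2 * (2 * x)) x := by
      have h := (hd x).hasDerivAt.sub ((hasDerivAt_pow 2 x).const_mul (|B| / 2))
      exact h.congr_deriv (by norm_num)
    rw [this.deriv]; ring
  have hg'' : deriv (fun x => deriv f x - |B| * x) = fun x => deriv (deriv f) x - |B| := by
    funext x
    have : HasDerivAt (fun x => deriv f x - |B| * x) (deriv (deriv f) x - |B| * 1) x :=
      (hd1 x).hasDerivAt.sub ((hasDerivAt_id x).const_mul |B|)
    rw [this.deriv]; ring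
  have hconc : ConcaveOn ℝ (Set.Icc (-R) R) (fun x => f x - |B| / 2 * x ^ 2) := by
    refine concaveOn_of_deriv2_nonpos' (convex_Icc _ _)
      (by fun_prop) ?_ ?_
    · rw [hg']; fun_prop
    · intro x hx
      simp only [Function.iterate_succ, Function.iterate_zero, Function.comp_apply, id]
      rw [hg', hg'']
      have := hB x hx
      rw [Real.norm_eq_abs] at this
      linarith [le_abs_self (deriv (deriv f) x), le_abs_self B]
  refine ⟨|B|, abs_nonneg _, fun x y hx hy => ?_⟩
  have h := hconc.2 (abs_le.1 hy) (abs_le.1 hx) (show (0 : ℝ) ≤ 1 / 2 by norm_num)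
    (show (0 : ℝ) ≤ 1 / 2 by norm_num) (by norm_num)
  have e : (1 / 2 : ℝ) • (2 * y - x) + (1 / 2 : ℝ) • x = y := by simp only [smul_eq_mul]; ring
  simp only [e] at h
  simp only [smul_eq_mul] at h
  nlinarith [h]

/-- If the likelihood ratio has second moment at most `1 + η²`, then probabilities grow by
at most `η`. -/
theorem withDensity_apply_le_add {Ω : Type*} [MeasurableSpace Ω] (P : Measure Ω)
    [IsProbabilityMeasure P] (ℓ : Ω → ℝ≥0∞) (hℓ : Measurable ℓ)
    [IsProbabilityMeasure (P.withDensity ℓ)] {η : ℝ} (hη : 0 < η)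
    (h2 : ∫⁻ x, ℓ x ^ 2 ∂P ≤ ENNReal.ofReal (1 + η ^ 2)) (D : Set Ω) (hD : MeasurableSet D) :
    (P.withDensity ℓ).real D ≤ P.real D + η := by
  have h1 : ∫⁻ x, ℓ x ∂P = 1 := by
    rw [← setLIntegral_univ, ← withDensity_apply _ MeasurableSet.univ, measure_univ]
  have h1D : ∫⁻ x, D.indicator ℓ x ∂P = P.withDensity ℓ D := by
    rw [lintegral_indicator hD, withDensity_apply _ hD]
  have hfin : ∀ᵐ x ∂P, ℓ x < ⊤ := ae_lt_top hℓ (by rw [h1]; simp)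
  -- On `D` this is `2η(ℓ - 1) ≤ η² + (ℓ - 1)²`, off `D` it follows from `2ℓ ≤ 1 + ℓ²`; terms are
  -- arranged so that nothing is subtracted in `ℝ≥0∞`. Integration, with `∫ ℓ = 1`, gives the
  -- result.
  have key : ∀ᵐ x ∂P, ENNReal.ofReal (2 * η) * D.indicator ℓ x + 2 * ℓ x ≤
      ENNReal.ofReal (2 * η) * D.indicator 1 x + (ENNReal.ofReal (η ^ 2) + 1) + ℓ x ^ 2 := by
    filter_upwards [hfin] with x hx
    lift ℓ x to NNReal using hx.ne with a ha
    by_cases hxD : x ∈ D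
    · simp only [Set.indicator_of_mem hxD, Pi.one_apply, ← ha]
      have e2 : (2 : ℝ≥0∞) = ENNReal.ofReal 2 := by simp
      have e1 : (1 : ℝ≥0∞) = ENNReal.ofReal 1 := by simp
      have ea : (a : ℝ≥0∞) = ENNReal.ofReal a := by simp
      rw [ea, e2, e1, ← ENNReal.ofReal_pow a.coe_nonneg, ← ENNReal.ofReal_mul (by positivity),
        ← ENNReal.ofReal_mul (by positivity), ← ENNReal.ofReal_mul (by positivity),
        ← ENNReal.ofReal_add (by positivity) (by positivity),
        ← ENNReal.ofReal_add (by positivity) (by positivity),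
        ← ENNReal.ofReal_add (by positivity) (by positivity),
        ← ENNReal.ofReal_add (by positivity) (by positivity)]
      refine ENNReal.ofReal_le_ofReal ?_
      nlinarith [sq_nonneg (η - (a - 1))]
    · simp only [Set.indicator_of_notMem hxD, mul_zero, zero_add]
      have e : (2 : ℝ≥0∞) * a ≤ 1 + (a : ℝ≥0∞) ^ 2 := by
        have : (2 : NNReal) * a ≤ 1 + a ^ 2 := by
          rw [← NNReal.coe_le_coe]; push_cast; nlinarith [sq_nonneg ((a : ℝ) - 1)]
        exact_mod_cast this
      refine e.trans ?_
      gcongr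
      exact le_add_self
  have hint := lintegral_mono_ae key
  rw [lintegral_add_right _ (by fun_prop), lintegral_const_mul _ (hℓ.indicator hD),
    lintegral_const_mul _ hℓ, h1D, h1, lintegral_add_right _ (by fun_prop),
    lintegral_add_right _ (by fun_prop), lintegral_const_mul _ (measurable_one.indicator hD),
    lintegral_indicator_one hD, lintegral_const, measure_univ, mul_one, mul_one] at hint
  have hint2 := hint.trans (add_le_add_right h2 _)
  have e1 : ENNReal.ofReal (2 * η) * P.withDensity ℓ D + 2 =
      ENNReal.ofReal (2 * η * (P.withDensity ℓ).real D + 2) := by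
    rw [ENNReal.ofReal_add (by positivity) (by positivity),
      ENNReal.ofReal_mul (p := 2 * η) (by positivity), ofReal_measureReal]
    simp
  have e2 : ENNReal.ofReal (2 * η) * P D + (ENNReal.ofReal (η ^ 2) + 1) +
      ENNReal.ofReal (1 + η ^ 2) =
      ENNReal.ofReal (2 * η * P.real D + (η ^ 2 + 1) + (1 + η ^ 2)) := by
    rw [ENNReal.ofReal_add (p := _ + (η ^ 2 + 1)) (by positivity) (by positivity),
      ENNReal.ofReal_add (q := η ^ 2 + 1) (by positivity) (by positivity),
      ENNReal.ofReal_add (p := η ^ 2) (by positivity) (by positivity),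
      ENNReal.ofReal_mul (p := 2 * η) (by positivity), ofReal_measureReal]
    simp
  rw [e1, e2, ENNReal.ofReal_le_ofReal_iff (by positivity)] at hint2
  nlinarith [hint2]

/-! ### Densities of product measures -/

section Product

variable {ι : Type*} [Fintype ι] (P : ι → Measure ℝ) [∀ i, IsProbabilityMeasure (P i)]

theorem lintegral_pi_prod (f : ι → ℝ → ℝ≥0∞) (hf : ∀ i, Measurable (f i)) :
    ∫⁻ y, ∏ i, f i (y i) ∂Measure.pi P = ∏ i, ∫⁻ x, f i x ∂P i := by
  refine (ProbabilityTheory.lintegral_prod_eq_prod_lintegral_of_indepFun Finset.univ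
    (fun i (y : ι → ℝ) => f i (y i))
    (ProbabilityTheory.iIndepFun_pi fun i => (hf i).aemeasurable)
    fun i => (hf i).comp (measurable_pi_apply i)).trans ?_
  refine Finset.prod_congr rfl fun i _ => ?_
  exact (measurePreserving_eval P i).lintegral_comp (hf i)

theorem pi_withDensity (f : ι → ℝ → ℝ≥0∞) (hf : ∀ i, Measurable (f i))
    [∀ i, IsProbabilityMeasure ((P i).withDensity (f i))] :
    Measure.pi (fun i => (P i).withDensity (f i)) =
      (Measure.pi P).withDensity fun y => ∏ i, f i (y i) := by
  refine Measure.pi_eq fun s hs => ?_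
  rw [withDensity_apply _ (MeasurableSet.univ_pi hs),
    ← lintegral_indicator (MeasurableSet.univ_pi hs)]
  have h : ∀ y : ι → ℝ, (Set.univ.pi s).indicator (fun y => ∏ i, f i (y i)) y =
      ∏ i, (s i).indicator (f i) (y i) := by
    intro y
    by_cases hy : y ∈ Set.univ.pi s
    · rw [Set.indicator_of_mem hy]
      exact Finset.prod_congr rfl fun i _ => (Set.indicator_of_mem (hy i trivial) _).symm
    · rw [Set.indicator_of_notMem hy]
      simp only [Set.mem_pi, Set.mem_univ, true_implies, not_forall] at hy
      obtain ⟨i, hi⟩ := hy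
      exact (Finset.prod_eq_zero (Finset.mem_univ i) (Set.indicator_of_notMem hi _)).symm
  simp_rw [h]
  rw [lintegral_pi_prod P _ fun i => (hf i).indicator (hs i)]
  refine Finset.prod_congr rfl fun i _ => ?_
  rw [lintegral_indicator (hs i), withDensity_apply _ (hs i)]

end Product

/-! ### Likelihood ratios in the exponential family -/

namespace ExpFamily

variable {F : ExpFamily}

/-- The likelihood ratio of the natural parameter `m'` against `m`. -/
def ratio (F : ExpFamily) (m m' : ℝ) (y : ℝ) : ℝ≥0∞ :=
  ENNReal.ofReal (Real.exp ((y * (m' - m) - ((F.b m').toReal - (F.b m).toReal)) / F.φ))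

theorem measurable_ratio (m m' : ℝ) : Measurable (F.ratio m m') := by
  unfold ratio; fun_prop

theorem measurable_density (m : ℝ) : Measurable fun y =>
    ENNReal.ofReal (Real.exp ((y * m - (F.b m).toReal) / F.φ + F.c y F.φ)) := by
  have := F.measurable_c
  fun_prop

theorem law_eq_withDensity_ratio (m m' : ℝ) :
    F.law m' = (F.law m).withDensity (F.ratio m m') := by
  rw [law, law, ← withDensity_mul _ (measurable_density m) (measurable_ratio m m')]
  congr 1
  funext y
  rw [Pi.mul_apply, ratio, ← ENNReal.ofReal_mul (Real.exp_pos _).le, ← Real.exp_add]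
  congr 2
  ring

/-- The density at `m` times the squared ratio is a constant times the density at `2 * m' - m`,
which integrates to one; the constant is the exponential of a second difference of `b`. -/
theorem lintegral_ratio_sq (h : F.FullNaturalSpace) (m m' : ℝ) :
    ∫⁻ y, F.ratio m m' y ^ 2 ∂F.law m = ENNReal.ofReal (Real.exp
      (((F.b (2 * m' - m)).toReal + (F.b m).toReal - 2 * (F.b m').toReal) / F.φ)) := by
  have hp := isProbabilityMeasure_law h (2 * m' - m)
  have h1 : F.law (2 * m' - m) Set.univ = 1 := measure_univ
  rw [law, withDensity_apply _ MeasurableSet.univ, Measure.restrict_univ] at h1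
  rw [law, lintegral_withDensity_eq_lintegral_mul _ (measurable_density m)
    ((measurable_ratio m m').pow_const 2)]
  rw [← mul_one (ENNReal.ofReal _), ← h1, ← lintegral_const_mul _ (measurable_density _)]
  congr 1
  funext y
  rw [Pi.mul_apply, ratio, ← ENNReal.ofReal_pow (Real.exp_pos _).le,
    ← ENNReal.ofReal_mul (Real.exp_pos _).le, ← ENNReal.ofReal_mul (Real.exp_pos _).le,
    ← Real.exp_nat_mul, ← Real.exp_add, ← Real.exp_add]
  congr 2
  push_cast
  ring

theorem Z_ne_zero_ne_top (h : F.FullNaturalSpace) (m : ℝ) : F.Z m ≠ 0 ∧ F.Z m ≠ ⊤ := by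
  have hφ := F.φ_pos
  have hm : (F.b m).abs < ⊤ := by
    have : m ∈ {ν : ℝ | (F.b ν).abs < ⊤} := by rw [h]; trivial
    exact this
  constructor
  · intro h0
    rw [b, h0, ENNReal.log_zero, EReal.coe_mul_bot_of_pos hφ] at hm
    simp at hm
  · intro h0
    rw [b, h0, ENNReal.log_top, EReal.coe_mul_top_of_pos hφ] at hm
    simp at hm

/-- Up to the scaling by `φ`, `b` is the cumulant generating function of the measure with density
`exp (c y φ)`. It is analytic inside the set where the exponential moments are finite, here the
whole line. -/
theorem contDiff_b (h : F.FullNaturalSpace) : ContDiff ℝ 2 fun m => (F.b m).toReal := by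
  set μ := F.ref.withDensity fun y => ENNReal.ofReal (Real.exp (F.c y F.φ)) with hμ
  have hc : Measurable fun y => ENNReal.ofReal (Real.exp (F.c y F.φ)) := by
    have := F.measurable_c
    fun_prop
  have hφ := F.φ_pos
  have hZ : ∀ t : ℝ, ∫⁻ y, ENNReal.ofReal (Real.exp (t * y)) ∂μ = F.Z (F.φ * t) := by
    intro t
    rw [hμ, lintegral_withDensity_eq_lintegral_mul _ hc (by fun_prop), Z]
    congr 1
    funext y
    rw [Pi.mul_apply, ← ENNReal.ofReal_mul (Real.exp_pos _).le, ← Real.exp_add]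
    congr 2
    field_simp
    ring
  have hint : ProbabilityTheory.integrableExpSet id μ = Set.univ := by
    refine Set.eq_univ_of_forall fun t => ?_
    refine (lintegral_ofReal_ne_top_iff_integrable (by fun_prop)
      (Eventually.of_forall fun y => (Real.exp_pos _).le)).1 ?_
    simp only [id]
    rw [hZ]
    exact (Z_ne_zero_ne_top h _).2
  have hb : (fun m => (F.b m).toReal) =
      fun m => F.φ * ProbabilityTheory.cgf id μ (m / F.φ) := by
    funext m
    obtain ⟨h0, ht⟩ := Z_ne_zero_ne_top h m
    rw [b, ENNReal.log_pos_real h0 ht, ← EReal.coe_mul, EReal.toReal_coe,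
      ProbabilityTheory.cgf, ProbabilityTheory.mgf,
      integral_eq_lintegral_of_nonneg_ae (Eventually.of_forall fun y => (Real.exp_pos _).le)
        (by fun_prop)]
    simp only [id]
    rw [hZ, mul_div_cancel₀ _ hφ.ne']
  have hcgf : ContDiff ℝ 2 (ProbabilityTheory.cgf id μ) := by
    rw [contDiff_iff_contDiffAt]
    intro t
    exact (ProbabilityTheory.analyticAt_cgf (by rw [hint]; simp)).contDiffAt
  rw [hb]
  fun_prop

theorem exists_lintegral_ratio_sq_le (h : F.FullNaturalSpace) (R : ℝ) :
    ∃ B : ℝ, 0 < B ∧ ∀ m m' : ℝ, |m| ≤ R → |m'| ≤ R →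
      ∫⁻ y, F.ratio m m' y ^ 2 ∂F.law m ≤ ENNReal.ofReal (Real.exp (B * (m' - m) ^ 2)) := by
  -- The reflected point `2 * m' - m` may leave `[-R, R]` but stays in `[-3R, 3R]`.
  obtain ⟨B, hB0, hB⟩ := exists_second_difference_le (contDiff_b h) (3 * R)
  have hφ := F.φ_pos
  refine ⟨B / F.φ + 1, by positivity, fun m m' hm hm' => ?_⟩
  rw [lintegral_ratio_sq h]
  refine ENNReal.ofReal_le_ofReal (Real.exp_le_exp.2 ?_)
  have hR : 0 ≤ R := (abs_nonneg m).trans hm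
  have h1 := hB m m' (by linarith) (by
    rw [abs_le] at hm hm' ⊢; constructor <;> linarith)
  rw [div_le_iff₀ hφ]
  have : (B / F.φ + 1) * (m' - m) ^ 2 * F.φ = B * (m' - m) ^ 2 + F.φ * (m' - m) ^ 2 := by
    field_simp
  rw [this]
  have : 0 ≤ F.φ * (m' - m) ^ 2 := by positivity
  linarith

/-- The law of the observed `N × J` block. -/
def blockLaw (h : F.FullNaturalSpace) {K : ℕ} (Θ A : Matrix ℕ (Fin K) ℝ) (N J : ℕ) :
    Measure (Fin N → Fin J → ℝ) :=
  (F.dataLaw h Θ A).map (dataBlock N J)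

theorem measurable_dataBlock (N J : ℕ) : Measurable (dataBlock N J) := by
  unfold dataBlock; fun_prop

instance (h : F.FullNaturalSpace) {K : ℕ} (Θ A : Matrix ℕ (Fin K) ℝ) :
    IsProbabilityMeasure (F.dataLaw h Θ A) := by
  have : ∀ m, IsProbabilityMeasure (F.law m) := isProbabilityMeasure_law h
  unfold dataLaw; infer_instance

instance (h : F.FullNaturalSpace) {K : ℕ} (Θ A : Matrix ℕ (Fin K) ℝ) (N J : ℕ) :
    IsProbabilityMeasure (F.blockLaw h Θ A N J) :=
  Measure.isProbabilityMeasure_map (measurable_dataBlock N J).aemeasurable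

/-- Second moments of likelihood ratios multiply over independent entries, so the exponents add up
to the squared Frobenius distance of the natural parameters. -/
theorem exists_blockLaw_le_add (h : F.FullNaturalSpace) (R : ℝ) :
    ∃ B : ℝ, 0 < B ∧ ∀ (K : ℕ) (Θ A Θ' A' : Matrix ℕ (Fin K) ℝ) (N J : ℕ),
      (∀ i < N, ∀ j < J, |A j ⬝ᵥ Θ i| ≤ R) → (∀ i < N, ∀ j < J, |A' j ⬝ᵥ Θ' i| ≤ R) →
      ∀ η : ℝ, 0 < η →
      B * ∑ i ∈ Finset.range N, ∑ j ∈ Finset.range J, (A' j ⬝ᵥ Θ' i - A j ⬝ᵥ Θ i) ^ 2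
        ≤ Real.log (1 + η ^ 2) →
      ∀ D, MeasurableSet D →
        (F.blockLaw h Θ' A' N J).real D ≤ (F.blockLaw h Θ A N J).real D + η := by
  obtain ⟨B, hB0, hB⟩ := exists_lintegral_ratio_sq_le h R
  refine ⟨B, hB0, fun K Θ A Θ' A' N J hm hm' η hη hsum D hD => ?_⟩
  have : ∀ m, IsProbabilityMeasure (F.law m) := isProbabilityMeasure_law h
  set I : Finset (ℕ × ℕ) := Finset.range N ×ˢ Finset.range J with hI
  have hmem : ∀ (i : Fin N) (j : Fin J), ((i : ℕ), (j : ℕ)) ∈ I := fun i j => by simp [hI]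
  set g : (I → ℝ) → Fin N → Fin J → ℝ := fun y i j => y ⟨(i, j), hmem i j⟩ with hg
  have hgm : Measurable g := by fun_prop
  have hmap : ∀ Θ A : Matrix ℕ (Fin K) ℝ, (F.blockLaw h Θ A N J).real D =
      (Measure.pi fun p : I => F.law (A p.1.2 ⬝ᵥ Θ p.1.1)).real (g ⁻¹' D) := by
    intro Θ A
    have h1 : F.blockLaw h Θ A N J =
        (Measure.pi fun p : I => F.law (A p.1.2 ⬝ᵥ Θ p.1.1)).map g := by
      have h2 : Measure.map I.restrict (F.dataLaw h Θ A) =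
          Measure.pi fun p : I => F.law (A p.1.2 ⬝ᵥ Θ p.1.1) :=
        Measure.infinitePi_map_restrict (fun p : ℕ × ℕ => F.law (A p.2 ⬝ᵥ Θ p.1))
      rw [← h2, Measure.map_map hgm (by fun_prop)]
      rfl
    rw [h1, map_measureReal_apply hgm hD]
  rw [hmap, hmap]
  set ℓ : I → ℝ → ℝ≥0∞ := fun p => F.ratio (A p.1.2 ⬝ᵥ Θ p.1.1) (A' p.1.2 ⬝ᵥ Θ' p.1.1)
  have hℓ : ∀ p, Measurable (ℓ p) := fun p => measurable_ratio _ _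
  have he : ∀ p : I, F.law (A' p.1.2 ⬝ᵥ Θ' p.1.1) =
      (F.law (A p.1.2 ⬝ᵥ Θ p.1.1)).withDensity (ℓ p) := fun p => law_eq_withDensity_ratio _ _
  have : ∀ p : I, IsProbabilityMeasure ((F.law (A p.1.2 ⬝ᵥ Θ p.1.1)).withDensity (ℓ p)) :=
    fun p => by rw [← he]; infer_instance
  simp_rw [he]
  have hpi := pi_withDensity (fun p : I => F.law (A p.1.2 ⬝ᵥ Θ p.1.1)) ℓ hℓ
  have : IsProbabilityMeasure
      ((Measure.pi fun p : I => F.law (A p.1.2 ⬝ᵥ Θ p.1.1)).withDensity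
        fun y => ∏ i, ℓ i (y i)) := by
    rw [← hpi]; infer_instance
  rw [hpi]
  refine withDensity_apply_le_add _ _ (by fun_prop) hη ?_ _ (hgm hD)
  simp_rw [← Finset.prod_pow]
  rw [lintegral_pi_prod _ (fun p y => ℓ p y ^ 2) fun p => (hℓ p).pow_const 2]
  calc ∏ p : I, ∫⁻ y, ℓ p y ^ 2 ∂F.law (A p.1.2 ⬝ᵥ Θ p.1.1)
      ≤ ∏ p : I, ENNReal.ofReal
        (Real.exp (B * (A' p.1.2 ⬝ᵥ Θ' p.1.1 - A p.1.2 ⬝ᵥ Θ p.1.1) ^ 2)) := by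
        refine Finset.prod_le_prod' fun p _ => ?_
        have hp := p.2
        simp only [hI, Finset.mem_product, Finset.mem_range] at hp
        exact hB _ _ (hm _ hp.1 _ hp.2) (hm' _ hp.1 _ hp.2)
    _ = ENNReal.ofReal (Real.exp (B * ∑ i ∈ Finset.range N, ∑ j ∈ Finset.range J,
          (A' j ⬝ᵥ Θ' i - A j ⬝ᵥ Θ i) ^ 2)) := by
        rw [← ENNReal.ofReal_prod_of_nonneg fun _ _ => (Real.exp_pos _).le, ← Real.exp_sum,
          ← Finset.mul_sum, ← Finset.sum_product', ← hI, ← Finset.sum_coe_sort I]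
    _ ≤ ENNReal.ofReal (1 + η ^ 2) := by
        refine ENNReal.ofReal_le_ofReal ?_
        rw [← Real.le_log_iff_exp_le (by positivity)]
        exact hsum

end ExpFamily

/-! ### A four-letter Assouad lemma -/

section Decoding

variable {ι Ω : Type*} [Fintype ι] [DecidableEq ι] [MeasurableSpace Ω]

/-- The choice depends on `y` only through the finite table of memberships `y ∈ G v`, a discrete
space on which every map is measurable. -/
theorem exists_measurable_selection (G : (ι → Fin 4) → Set Ω) (hG : ∀ v, MeasurableSet (G v)) :
    ∃ f : Ω → ι → Fin 4, Measurable f ∧ ∀ v y, y ∈ G v → y ∈ G (f y) := by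
  classical
  let sel : ((ι → Fin 4) → Prop) → ι → Fin 4 := fun s => if h : ∃ v, s v then h.choose else 0
  refine ⟨fun y => sel fun v => y ∈ G v, ?_, fun v y hy => ?_⟩
  · have hsel : Measurable sel := Measurable.of_discrete
    refine hsel.comp (measurable_pi_lambda _ fun v => ?_)
    exact measurableSet_setOfPred.1 (hG v)
  · have h : ∃ v, y ∈ G v := ⟨v, hy⟩
    simp only [sel, dif_pos h]
    exact h.choose_spec

variable (P : (ι → Fin 4) → Measure Ω) [∀ v, IsProbabilityMeasure (P v)]

/-- Shifting coordinate `i` by `a` permutes the hypercube, so the sum can be averaged over the four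
shifts. Moving each shifted law back to `P v` costs 1/8, and under one law the four guesses have
total probability one: `4 * sum ≤ (1 + 4/8) * card`. -/
theorem sum_prob_correct_le (i : ι)
    (hP : ∀ v v', (∀ j, j ≠ i → v' j = v j) → ∀ D, MeasurableSet D →
      (P v').real D ≤ (P v).real D + 1 / 8)
    (f : Ω → ι → Fin 4) (hf : Measurable f) :
    ∑ v, (P v).real {y | f y i = v i} ≤ 3 / 8 * Fintype.card (ι → Fin 4) := by
  have hD : ∀ a, MeasurableSet {y | f y i = a} := fun a =>
    (measurable_pi_apply i).comp hf (measurableSet_singleton a)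
  have shift : ∀ a : Fin 4, ∑ v, (P v).real {y | f y i = v i} =
      ∑ v : ι → Fin 4, (P (v + Pi.single i a)).real {y | f y i = v i + a} := by
    intro a
    rw [← Equiv.sum_comp (Equiv.addRight (Pi.single i a : ι → Fin 4))]
    simp
  have total : ∀ v, ∑ a, (P v).real {y | f y i = v i + a} = 1 := by
    intro v
    have h1 : ∑ a, (P v).real {y | f y i = v i + a} = ∑ a, (P v).real {y | f y i = a} :=
      Equiv.sum_comp (Equiv.addLeft (v i)) fun a => (P v).real {y | f y i = a}
    rw [h1, ← measureReal_iUnion_fintype _ hD]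
    · have : ⋃ a, {y | f y i = a} = Set.univ := by ext; simp
      rw [this, probReal_univ]
    · intro a b hab
      exact Set.disjoint_left.2 fun y (h : f y i = a) (h' : f y i = b) => hab (h.symm.trans h')
  have h4 : (4 : ℝ) * ∑ v, (P v).real {y | f y i = v i} =
      ∑ a : Fin 4, ∑ v : ι → Fin 4, (P (v + Pi.single i a)).real {y | f y i = v i + a} := by
    rw [← Finset.sum_congr rfl fun a _ => shift a]
    simp
  have h5 : ∑ a : Fin 4, ∑ v : ι → Fin 4, (P (v + Pi.single i a)).real {y | f y i = v i + a} ≤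
      ∑ a : Fin 4, ∑ v, ((P v).real {y | f y i = v i + a} + 1 / 8) := by
    refine Finset.sum_le_sum fun a _ => Finset.sum_le_sum fun v _ => hP _ _ ?_ _ (hD _)
    intro j hj
    simp [hj]
  have h6 : ∑ a : Fin 4, ∑ v, ((P v).real {y | f y i = v i + a} + 1 / 8) =
      3 / 2 * Fintype.card (ι → Fin 4) := by
    rw [Finset.sum_comm]
    simp_rw [Finset.sum_add_distrib, total]
    simp only [Finset.sum_const, Finset.card_univ, Fintype.card_fin, nsmul_eq_mul]
    push_cast
    ring
  linarith

/-- If changing one coordinate `i ∈ T` of `v` changes probabilities by at most `1/8`, and no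
outcome is a success for two parameters that differ on more than one eighth of `T`, then for
some parameter the success probability is at most one half. -/
theorem exists_half_le_failure (T : Finset ι) (hT : T.Nonempty)
    (hP : ∀ i ∈ T, ∀ v v', (∀ j, j ≠ i → v' j = v j) → ∀ D, MeasurableSet D →
      (P v').real D ≤ (P v).real D + 1 / 8)
    (G : (ι → Fin 4) → Set Ω) (hG : ∀ v, MeasurableSet (G v))
    (hd : ∀ v v' y, y ∈ G v → y ∈ G v' → 8 * (T.filter fun i => v i ≠ v' i).card ≤ T.card) :
    ∃ v, (1 / 2 : ℝ≥0∞) ≤ P v (G v)ᶜ := by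
  by_contra! hcon
  obtain ⟨f, hf, hfG⟩ := exists_measurable_selection G hG
  have hGv : ∀ v, 1 / 2 < (P v).real (G v) := by
    intro v
    have h1 : (P v).real (G v)ᶜ < 1 / 2 := by
      have := (ENNReal.toReal_lt_toReal (measure_ne_top _ _) (by simp)).2 (hcon v)
      simpa [Measure.real] using this
    rw [probReal_compl_eq_one_sub (hG v)] at h1
    linarith
  have hD : ∀ (i : ι) (a : Fin 4), MeasurableSet {y | f y i = a} := fun i a =>
    (measurable_pi_apply i).comp hf (measurableSet_singleton a)
  have hT0 : (0 : ℝ) < T.card := by exact_mod_cast hT.card_pos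
  -- When `y ∈ G v`, the selected index `f y` is also successful at `y`, so it agrees with `v` on at
  -- least 7/8 of `T`; this event has probability above 1/2.
  have lower : ∀ v, 7 / 16 * (T.card : ℝ) < ∑ i ∈ T, (P v).real {y | f y i = v i} := by
    intro v
    have h1 : ∑ i ∈ T, (P v).real {y | f y i = v i} =
        ∫ y, ∑ i ∈ T, {y | f y i = v i}.indicator (1 : Ω → ℝ) y ∂P v := by
      rw [integral_finsetSum _ fun i _ => (integrable_const 1).indicator (hD i _)]
      exact Finset.sum_congr rfl fun i _ => (integral_indicator_one (hD i _)).symm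
    have h2 : ∫ y, (7 / 8 * (T.card : ℝ)) * (G v).indicator (1 : Ω → ℝ) y ∂P v ≤
        ∫ y, ∑ i ∈ T, {y | f y i = v i}.indicator (1 : Ω → ℝ) y ∂P v := by
      refine integral_mono (((integrable_const 1).indicator (hG v)).const_mul _)
        (integrable_finsetSum _ fun i _ => (integrable_const 1).indicator (hD i _)) ?_
      intro y
      by_cases hy : y ∈ G v
      · have h3 := hd v (f y) y hy (hfG v y hy)
        have h4 := Finset.card_filter_add_card_filter_not (s := T) (fun i => v i ≠ f y i)
        have h5 : ∑ i ∈ T, {y | f y i = v i}.indicator (1 : Ω → ℝ) y =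
            ((T.filter fun i => ¬ v i ≠ f y i).card : ℝ) := by
          rw [Finset.card_filter, Nat.cast_sum]
          refine Finset.sum_congr rfl fun i _ => ?_
          by_cases hi : f y i = v i
          · simp [hi]
          · simp [hi, Ne.symm hi]
        simp only [Set.indicator_of_mem hy, Pi.one_apply, mul_one]
        rw [h5]
        have h6 : (8 : ℝ) * ((T.filter fun i => v i ≠ f y i).card : ℝ) ≤ T.card := by
          exact_mod_cast h3
        have h7 : ((T.filter fun i => v i ≠ f y i).card : ℝ) +
            ((T.filter fun i => ¬ v i ≠ f y i).card : ℝ) = T.card := by exact_mod_cast h4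
        linarith
      · simp only [Set.indicator_of_notMem hy, mul_zero]
        exact Finset.sum_nonneg fun i _ => Set.indicator_nonneg (fun _ _ => zero_le_one) _
    rw [integral_const_mul, integral_indicator_one (hG v)] at h2
    rw [h1]
    refine lt_of_lt_of_le ?_ h2
    nlinarith [hGv v]
  have upper : ∑ v, ∑ i ∈ T, (P v).real {y | f y i = v i} ≤
      3 / 8 * T.card * Fintype.card (ι → Fin 4) := by
    rw [Finset.sum_comm]
    calc ∑ i ∈ T, ∑ v, (P v).real {y | f y i = v i}
        ≤ ∑ _i ∈ T, 3 / 8 * (Fintype.card (ι → Fin 4) : ℝ) :=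
          Finset.sum_le_sum fun i hi => sum_prob_correct_le P i (hP i hi) f hf
      _ = _ := by rw [Finset.sum_const, nsmul_eq_mul]; ring
  have lower' : Fintype.card (ι → Fin 4) * (7 / 16 * (T.card : ℝ)) ≤
      ∑ v, ∑ i ∈ T, (P v).real {y | f y i = v i} := by
    have := Finset.card_nsmul_le_sum Finset.univ _ _ fun v _ => (lower v).le
    simpa [nsmul_eq_mul] using this
  have hV : (0 : ℝ) < Fintype.card (ι → Fin 4) := by exact_mod_cast Fintype.card_pos
  nlinarith [mul_pos hV hT0]

end Decoding

/-! ### Frequent factors of the design -/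

section Design

variable {K : ℕ} {Q : ℕ → Fin K → Bool}

theorem tendsto_freq (hQ : StableDesign Q) (S : Finset (Fin K)) :
    Tendsto (freq Q S) atTop (𝓝 (pQ Q S)) :=
  tendsto_nhds_limUnder (hQ.1 S)

theorem mem_RQ_iff (S : Finset (Fin K)) (j : ℕ) :
    j ∈ RQ Q S ↔ S = Finset.univ.filter fun k => Q j k = true := by
  constructor
  · rintro ⟨h1, h2⟩
    ext k
    simp only [Finset.mem_filter, Finset.mem_univ, true_and]
    refine ⟨h1 k, fun h => ?_⟩
    by_contra hk
    rw [h2 k hk] at h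
    exact Bool.false_ne_true h
  · rintro rfl
    exact ⟨fun k hk => by simpa using hk, fun k hk => by simpa using hk⟩

theorem infinite_RQ_of_pQ_pos (hQ : StableDesign Q) {S : Finset (Fin K)} (hS : 0 < pQ Q S) :
    Set.Infinite {j | j ∈ RQ Q S} := by
  intro hfin
  have h1 : Tendsto (freq Q S) atTop (𝓝 0) := by
    refine squeeze_zero (fun J => by unfold freq; positivity)
      (g := fun J : ℕ => (hfin.toFinset.card : ℝ) / J) (fun J => ?_)
      (tendsto_const_div_atTop_nhds_zero_nat _)
    unfold freq
    gcongr
    rw [Nat.count_eq_card_filter_range]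
    refine Finset.card_le_card fun j hj => ?_
    simp only [Finset.mem_filter] at hj
    exact hfin.mem_toFinset.2 hj.2
  exact hS.ne' (tendsto_nhds_unique (tendsto_freq hQ S) h1)

theorem sum_freq {J : ℕ} (hJ : 0 < J) : ∑ S, freq Q S J = 1 := by
  unfold freq
  rw [← Finset.sum_div, div_eq_one_iff_eq (by positivity), ← Nat.cast_sum]
  congr 1
  simp_rw [Nat.count_eq_card_filter_range, mem_RQ_iff]
  have := Finset.card_eq_sum_card_fiberwise (s := Finset.range J) (t := Finset.univ)
    (f := fun j => Finset.univ.filter fun k => Q j k = true) (fun _ _ => by simp)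
  rw [Finset.card_range] at this
  refine Eq.trans ?_ this.symm
  refine Finset.sum_congr rfl fun S _ => ?_
  congr 1
  ext j
  simp only [Finset.mem_filter]
  exact ⟨fun h => ⟨h.1, h.2.symm⟩, fun h => ⟨h.1, h.2.symm⟩⟩

/-- Each item lies in exactly one `RQ Q S`, so the finitely many limiting proportions sum to one. -/
theorem exists_pQ_pos (hQ : StableDesign Q) : ∃ S, 0 < pQ Q S := by
  by_contra! hcon
  have h1 : Tendsto (fun J => ∑ S, freq Q S J) atTop (𝓝 (∑ S, pQ Q S)) :=
    tendsto_finsetSum _ fun S _ => tendsto_freq hQ S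
  have h2 : Tendsto (fun J => ∑ S, freq Q S J) atTop (𝓝 1) := by
    refine tendsto_const_nhds.congr' ?_
    filter_upwards [eventually_gt_atTop 0] with J hJ
    exact (sum_freq hJ).symm
  have h3 := tendsto_nhds_unique h1 h2
  have h4 : ∑ S, pQ Q S ≤ 0 := Finset.sum_nonpos fun S _ => hcon S
  linarith

theorem exists_factor_frequent (hQ : StableDesign Q) :
    ∃ (k : Fin K) (p : ℝ) (J₀ : ℕ), 0 < p ∧ ∀ J, J₀ ≤ J →
      p * J ≤ ((Finset.univ : Finset (Fin J)).filter fun j : Fin J => Q j k = true).card := by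
  obtain ⟨S, hS⟩ := exists_pQ_pos hQ
  have hne : S.Nonempty := by
    rw [Finset.nonempty_iff_ne_empty]
    rintro rfl
    exact hS.ne' hQ.2
  obtain ⟨k, hk⟩ := hne
  have hev : ∀ᶠ J in atTop, pQ Q S / 2 < freq Q S J :=
    (tendsto_freq hQ S).eventually_const_lt (half_lt_self hS)
  obtain ⟨J₀, hJ₀⟩ := eventually_atTop.1 hev
  refine ⟨k, pQ Q S / 2, J₀ + 1, half_pos hS, fun J hJ => ?_⟩
  have h1 := hJ₀ J (by omega)
  have hJ0 : (0 : ℝ) < J := by exact_mod_cast (by omega : 0 < J)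
  rw [freq, lt_div_iff₀ hJ0] at h1
  refine h1.le.trans ?_
  rw [Nat.count_eq_card_filter_range]
  have : (Finset.range J).filter (· ∈ RQ Q S) ⊆
      ((Finset.univ : Finset (Fin J)).filter fun j : Fin J => Q j k = true).image Fin.val := by
    intro j hj
    simp only [Finset.mem_filter, Finset.mem_range] at hj
    simp only [Finset.mem_image, Finset.mem_filter, Finset.mem_univ, true_and]
    exact ⟨⟨j, hj.1⟩, hj.2.1 k hk, rfl⟩
  exact_mod_cast (Finset.card_le_card this).trans Finset.card_image_le

end Design

/-! ### Admissible scores and loadings -/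

section Parameters

variable {K : ℕ}

theorem norm_toLp_single (k : Fin K) (x : ℝ) :
    ‖WithLp.toLp 2 (Pi.single k x : Fin K → ℝ)‖ = |x| := by
  rw [EuclideanSpace.norm_eq]
  simp [Pi.single_apply, Real.sqrt_sq_eq_abs]

theorem abs_entry_le_norm (x : Fin K → ℝ) (k : Fin K) : |x k| ≤ ‖WithLp.toLp 2 x‖ :=
  PiLp.norm_apply_le (WithLp.toLp 2 x) k

/-- Factor scores whose first `N` rows are `u i • e_k`. -/
def scoreMat (C : ℝ) (k : Fin K) (N : ℕ) (u : ℕ → ℝ) : Matrix ℕ (Fin K) ℝ := fun i =>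
  if i < N then Pi.single k (u i)
  else haveI : Nonempty (Fin K) := ⟨k⟩; Pi.single (cyc (Fin K) i) C

/-- The first `N` rows span at most one direction; `γ` is positive because of the unobserved cyclic
rows alone. -/
theorem scoreMat_mem {C : ℝ} (hC : 0 < C) (k : Fin K) (N : ℕ) (u : ℕ → ℝ)
    (hu : ∀ i, |u i| ≤ C) : scoreMat C k N u ∈ SQ1 K C := by
  have : Nonempty (Fin K) := ⟨k⟩
  refine ⟨fun i => ?_, gam_pos_of_eventually_cyc _ hC N fun n hn => ?_⟩
  · unfold scoreMat
    split_ifs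
    · rw [norm_toLp_single]; exact hu i
    · rw [norm_toLp_single, abs_of_pos hC]
  · unfold scoreMat
    rw [if_neg (by omega)]

variable (Q : ℕ → Fin K → Bool)

/-- Loadings which respect the design and whose first `J` rows are `w j • e_k`
where the design allows it. -/
def loadMat (C : ℝ) (k : Fin K) (J : ℕ) (w : ℕ → ℝ) : Matrix ℕ (Fin K) ℝ := fun j =>
  if j < J then (if Q j k = true then Pi.single k (w j) else 0)
  else
    if h : (Finset.univ.filter fun k => Q j k = true).Nonempty then
      haveI := h.to_subtype
      Pi.single (cyc (Finset.univ.filter fun k => Q j k = true : Finset (Fin K))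
        (Nat.count (· ∈ RQ Q (Finset.univ.filter fun k => Q j k = true)) j) : Fin K) C
    else 0

variable {Q}

theorem loadMat_of_mem_RQ (C : ℝ) (k : Fin K) {J j : ℕ} (w : ℕ → ℝ) (hj : J ≤ j)
    {S : Finset (Fin K)} [hS : Nonempty S] (h : j ∈ RQ Q S) :
    loadMat Q C k J w j = Pi.single (cyc S (Nat.count (· ∈ RQ Q S) j) : Fin K) C := by
  obtain rfl := (mem_RQ_iff S j).1 h
  rw [loadMat, if_neg (by omega), dif_pos (Finset.nonempty_coe_sort.1 hS)]

/-- Beyond `J`, a row in `RQ Q S` is chosen by its rank within `RQ Q S`, so the submatrix of each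
class with positive proportion is itself eventually cyclic. -/
theorem loadMat_mem (hQ : StableDesign Q) {C : ℝ} (hC : 0 < C) (k : Fin K) (J : ℕ) (w : ℕ → ℝ)
    (hw : ∀ j, |w j| ≤ C) : loadMat Q C k J w ∈ SQ2 Q C := by
  refine ⟨fun j => ?_, fun S j hj k' hk' => ?_, fun S hS => ?_⟩
  · unfold loadMat
    split_ifs
    · rw [norm_toLp_single]; exact hw j
    · simpa using hC.le
    · rw [norm_toLp_single, abs_of_pos hC]
    · simpa using hC.le
  · by_cases hjJ : j < J
    · rw [loadMat, if_pos hjJ]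
      split_ifs with hQk
      · refine Pi.single_eq_of_ne ?_ _
        rintro rfl
        rw [hj.2 _ hk'] at hQk
        exact Bool.false_ne_true hQk
      · rfl
    · rcases S.eq_empty_or_nonempty with rfl | hne
      · rw [loadMat, if_neg hjJ, dif_neg]
        · rfl
        · rw [← (mem_RQ_iff _ j).1 hj]; simp
      · have := hne.to_subtype
        rw [loadMat_of_mem_RQ C k w (not_lt.1 hjJ) hj]
        refine Pi.single_eq_of_ne ?_ _
        rintro rfl
        exact hk' (Subtype.property _)
  · have hne : S.Nonempty := by
      rw [Finset.nonempty_iff_ne_empty]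
      rintro rfl
      exact hS.ne' hQ.2
    have := hne.to_subtype
    have hinf := infinite_RQ_of_pQ_pos hQ hS
    refine gam_pos_of_eventually_cyc _ hC J fun n hn => ?_
    -- Row `n` of the submatrix is a row of index at least `n` of the full matrix, so `n ≥ J` puts
    -- it outside the perturbed block.
    have h1 : n ≤ Nat.nth (· ∈ RQ Q S) n := (Nat.nth_strictMono hinf).le_apply
    have h2 : Nat.nth (· ∈ RQ Q S) n ∈ RQ Q S := Nat.nth_mem_of_infinite hinf n
    funext a
    change loadMat Q C k J w (Nat.nth (· ∈ RQ Q S) n) a = _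
    rw [loadMat_of_mem_RQ C k w (hn.trans h1) h2, Nat.count_nth_of_infinite hinf]
    rcases eq_or_ne a (cyc S n) with rfl | ha
    · rw [Pi.single_eq_same, Pi.single_eq_same]
    · rw [Pi.single_eq_of_ne ha, Pi.single_eq_of_ne fun h => ha (Subtype.ext h)]

end Parameters

/-! ### The hypercube of perturbations -/

section Levels

variable {N : ℕ}

/-- The entries `C / 2 + δ v i` for `i ∈ T`, and `C / 2` elsewhere. -/
def level (T : Finset (Fin N)) (C δ : ℝ) (v : Fin N → Fin 4) (i : ℕ) : ℝ :=
  C / 2 + δ * if h : i < N then (if ⟨i, h⟩ ∈ T then ((v ⟨i, h⟩ : ℕ) : ℝ) else 0) else 0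

variable {T : Finset (Fin N)} {C δ : ℝ}

theorem level_bounds (hδ : 0 ≤ δ) (hδC : δ ≤ C / 6) (v : Fin N → Fin 4) (i : ℕ) :
    C / 2 ≤ level T C δ v i ∧ level T C δ v i ≤ C := by
  have h : ∀ a : ℝ, 0 ≤ a → a ≤ 3 → C / 2 ≤ C / 2 + δ * a ∧ C / 2 + δ * a ≤ C := by
    intro a h0 h3
    constructor <;> nlinarith
  unfold level
  apply h
  · split_ifs <;> positivity
  · split_ifs with h1 h2
    · exact_mod_cast (by omega : (v ⟨i, h1⟩ : ℕ) ≤ 3)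
    · norm_num
    · norm_num

theorem abs_level_le (hδ : 0 ≤ δ) (hδC : δ ≤ C / 6) (v : Fin N → Fin 4) (i : ℕ) :
    |level T C δ v i| ≤ C := by
  have := level_bounds (T := T) hδ hδC v i
  rw [abs_le]
  constructor <;> linarith

theorem level_of_notMem (v : Fin N → Fin 4) {i : Fin N} (h : i ∉ T) :
    level T C δ v i = C / 2 := by
  simp [level, h]

theorem level_of_mem (v : Fin N → Fin 4) {i : Fin N} (h : i ∈ T) :
    level T C δ v i = C / 2 + δ * ((v i : ℕ) : ℝ) := by
  simp [level, h]

theorem sum_sq_level_sub_le (v v' : Fin N → Fin 4) (i : Fin N) (h : ∀ j, j ≠ i → v' j = v j) :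
    ∑ j ∈ Finset.range N, (level T C δ v' j - level T C δ v j) ^ 2 ≤ 9 * δ ^ 2 := by
  rw [← Fin.sum_univ_eq_sum_range (fun j => (level T C δ v' j - level T C δ v j) ^ 2),
    Finset.sum_eq_single i]
  · by_cases hi : i ∈ T
    · rw [level_of_mem _ hi, level_of_mem _ hi]
      have h1 : ((v i : ℕ) : ℝ) ≤ 3 := by exact_mod_cast (by omega : (v i : ℕ) ≤ 3)
      have h2 : ((v' i : ℕ) : ℝ) ≤ 3 := by exact_mod_cast (by omega : (v' i : ℕ) ≤ 3)
      have h3 : (0 : ℝ) ≤ ((v i : ℕ) : ℝ) := by positivity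
      have h4 : (0 : ℝ) ≤ ((v' i : ℕ) : ℝ) := by positivity
      have h5 : (((v' i : ℕ) : ℝ) - ((v i : ℕ) : ℝ)) ^ 2 ≤ 9 := by nlinarith
      calc _ = (((v' i : ℕ) : ℝ) - ((v i : ℕ) : ℝ)) ^ 2 * δ ^ 2 := by ring
        _ ≤ _ := mul_le_mul_of_nonneg_right h5 (sq_nonneg _)
    · rw [level_of_notMem _ hi, level_of_notMem _ hi, sub_self, zero_pow two_ne_zero]
      positivity
  · intro j _ hj
    by_cases hjT : j ∈ T
    · rw [level_of_mem _ hjT, level_of_mem _ hjT, h j hj]; simp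
    · rw [level_of_notMem _ hjT, level_of_notMem _ hjT]; simp
  · simp

theorem card_mul_sq_le_sum (T : Finset (Fin N)) (C δ : ℝ) (v v' : Fin N → Fin 4) :
    ((T.filter fun i => v i ≠ v' i).card : ℝ) * δ ^ 2 ≤
      ∑ i ∈ T, (level T C δ v i - level T C δ v' i) ^ 2 := by
  rw [← nsmul_eq_mul, ← Finset.sum_const]
  refine (Finset.sum_le_sum fun i hi => ?_).trans
    (Finset.sum_le_sum_of_subset_of_nonneg (Finset.filter_subset _ _) fun _ _ _ => sq_nonneg _)
  simp only [Finset.mem_filter] at hi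
  rw [level_of_mem _ hi.1, level_of_mem _ hi.1]
  have h1 : (1 : ℝ) ≤ (((v i : ℕ) : ℝ) - ((v' i : ℕ) : ℝ)) ^ 2 := by
    have h2 : ((v i : ℕ) : ℤ) - ((v' i : ℕ) : ℤ) ≠ 0 := by
      have := fun h => hi.2 (Fin.ext h)
      omega
    have h3 : (1 : ℤ) ≤ (((v i : ℕ) : ℤ) - ((v' i : ℕ) : ℤ)) ^ 2 :=
      Int.add_one_le_iff.2 (sq_pos_iff.2 h2)
    exact_mod_cast h3
  calc δ ^ 2 = 1 * δ ^ 2 := (one_mul _).symm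
    _ ≤ (((v i : ℕ) : ℝ) - ((v' i : ℕ) : ℝ)) ^ 2 * δ ^ 2 :=
      mul_le_mul_of_nonneg_right h1 (sq_nonneg _)
    _ = _ := by ring

end Levels

/-! ### Small angles and collinearity -/

section Angle

theorem measurable_sinAngle {n : ℕ} (v : Fin n → ℝ) : Measurable fun u => sinAngle u v := by
  unfold sinAngle dotProduct
  fun_prop

/-- Two vectors that both have a small angle with `w` are almost collinear. -/
theorem exists_sum_sq_sub_smul_le {n : ℕ} (w v v' : Fin n → ℝ) {r : ℝ} (hr : 0 < r)
    (hr2 : r ≤ 1 / 2) (h : sinAngle w v < r) (h' : sinAngle w v' < r) :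
    ∃ s : ℝ, ∑ i, (v i - s * v' i) ^ 2 ≤ 5 * r ^ 2 * ∑ i, v i ^ 2 := by
  have hr4 : r ^ 2 ≤ 1 / 4 := by nlinarith
  have key : ∀ v : Fin n → ℝ, sinAngle w v < r → 0 < w ⬝ᵥ w ∧ 0 < v ⬝ᵥ v ∧
      (1 - r ^ 2) * ((w ⬝ᵥ w) * (v ⬝ᵥ v)) < (w ⬝ᵥ v) ^ 2 := by
    intro v h
    rw [sinAngle, Real.sqrt_lt' hr] at h
    have hw : 0 ≤ w ⬝ᵥ w := Finset.sum_nonneg fun i _ => mul_self_nonneg _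
    have hv : 0 ≤ v ⬝ᵥ v := Finset.sum_nonneg fun i _ => mul_self_nonneg _
    -- If either vector is zero, division by zero makes the sine equal to 1, which exceeds `r`.
    have hne : (w ⬝ᵥ w) * (v ⬝ᵥ v) ≠ 0 := by
      intro h0
      rw [h0, div_zero] at h
      linarith
    have hw' : 0 < w ⬝ᵥ w := lt_of_le_of_ne hw fun h0 => hne (by rw [← h0, zero_mul])
    have hv' : 0 < v ⬝ᵥ v := lt_of_le_of_ne hv fun h0 => hne (by rw [← h0, mul_zero])
    refine ⟨hw', hv', ?_⟩
    rw [← lt_div_iff₀ (mul_pos hw' hv')]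
    linarith
  obtain ⟨hW, hV, ha⟩ := key v h
  obtain ⟨-, hV', ha'⟩ := key v' h'
  have cs : (w ⬝ᵥ v) ^ 2 ≤ (w ⬝ᵥ w) * (v ⬝ᵥ v) := by
    have := Finset.sum_mul_sq_le_sq_mul_sq Finset.univ w v
    simpa [dotProduct, sq] using this
  have resid : ∀ v : Fin n → ℝ,
      ∑ i, (v i - (w ⬝ᵥ v) / (w ⬝ᵥ w) * w i) ^ 2 = v ⬝ᵥ v - (w ⬝ᵥ v) ^ 2 / (w ⬝ᵥ w) := by
    intro v
    have e : ∀ i, (v i - (w ⬝ᵥ v) / (w ⬝ᵥ w) * w i) ^ 2 =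
        v i * v i - 2 * ((w ⬝ᵥ v) / (w ⬝ᵥ w)) * (w i * v i) +
          ((w ⬝ᵥ v) / (w ⬝ᵥ w)) ^ 2 * (w i * w i) := fun i => by ring
    simp_rw [e]
    rw [Finset.sum_add_distrib, Finset.sum_sub_distrib, ← Finset.mul_sum, ← Finset.mul_sum]
    change v ⬝ᵥ v - 2 * ((w ⬝ᵥ v) / (w ⬝ᵥ w)) * (w ⬝ᵥ v) +
      ((w ⬝ᵥ v) / (w ⬝ᵥ w)) ^ 2 * (w ⬝ᵥ w) = _
    field_simp
    ring
  have rlt : ∀ v : Fin n → ℝ, (1 - r ^ 2) * ((w ⬝ᵥ w) * (v ⬝ᵥ v)) < (w ⬝ᵥ v) ^ 2 →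
      v ⬝ᵥ v - (w ⬝ᵥ v) ^ 2 / (w ⬝ᵥ w) ≤ r ^ 2 * (v ⬝ᵥ v) := by
    intro v hv
    have : (1 - r ^ 2) * (v ⬝ᵥ v) ≤ (w ⬝ᵥ v) ^ 2 / (w ⬝ᵥ w) := by
      rw [le_div_iff₀ hW]; nlinarith
    linarith
  have hpos' : 0 < (1 - r ^ 2) * ((w ⬝ᵥ w) * (v' ⬝ᵥ v')) :=
    mul_pos (by linarith) (mul_pos hW hV')
  have ha0 : w ⬝ᵥ v' ≠ 0 := by
    intro h0
    rw [h0] at ha'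
    simp only [ne_eq, OfNat.ofNat_ne_zero, not_false_eq_true, zero_pow] at ha'
    linarith
  -- This ratio cancels the projections of `v` and `s • v'` onto `w`, leaving only the residuals.
  -- The constant is `2 + 2 * 4/3 ≤ 5`.
  set s := (w ⬝ᵥ v) / (w ⬝ᵥ v') with hs
  have hs2 : s ^ 2 * (v' ⬝ᵥ v') ≤ 4 / 3 * (v ⬝ᵥ v) := by
    have h1 : s ^ 2 * (w ⬝ᵥ v') ^ 2 = (w ⬝ᵥ v) ^ 2 := by
      rw [hs, div_pow, div_mul_cancel₀ _ (pow_ne_zero 2 ha0)]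
    have h2 : s ^ 2 * ((1 - r ^ 2) * ((w ⬝ᵥ w) * (v' ⬝ᵥ v'))) ≤ (w ⬝ᵥ w) * (v ⬝ᵥ v) :=
      (mul_le_mul_of_nonneg_left ha'.le (sq_nonneg s)).trans (h1.le.trans cs)
    have h3 : (w ⬝ᵥ w) * (3 / 4 * (s ^ 2 * (v' ⬝ᵥ v'))) ≤ (w ⬝ᵥ w) * (v ⬝ᵥ v) := by
      refine le_trans ?_ h2
      have : 0 ≤ s ^ 2 * ((w ⬝ᵥ w) * (v' ⬝ᵥ v')) := by positivity
      nlinarith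
    have := le_of_mul_le_mul_left h3 hW
    linarith
  have hVsum : ∑ i, v i ^ 2 = v ⬝ᵥ v := by simp [dotProduct, sq]
  refine ⟨s, ?_⟩
  rw [hVsum]
  have hle : ∑ i, (v i - s * v' i) ^ 2 ≤
      2 * (∑ i, (v i - (w ⬝ᵥ v) / (w ⬝ᵥ w) * w i) ^ 2) +
      2 * s ^ 2 * ∑ i, (v' i - (w ⬝ᵥ v') / (w ⬝ᵥ w) * w i) ^ 2 := by
    rw [Finset.mul_sum, Finset.mul_sum, ← Finset.sum_add_distrib]
    refine Finset.sum_le_sum fun i _ => ?_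
    have e : v i - s * v' i = (v i - (w ⬝ᵥ v) / (w ⬝ᵥ w) * w i) -
        s * (v' i - (w ⬝ᵥ v') / (w ⬝ᵥ w) * w i) := by
      rw [hs]; field_simp; ring
    rw [e]
    nlinarith [sq_nonneg ((v i - (w ⬝ᵥ v) / (w ⬝ᵥ w) * w i) +
        s * (v' i - (w ⬝ᵥ v') / (w ⬝ᵥ w) * w i))]
  rw [resid, resid] at hle
  have h1 := rlt v ha
  have h2 := mul_le_mul_of_nonneg_left (rlt v' ha') (show 0 ≤ 2 * s ^ 2 by positivity)
  have h3 := mul_le_mul_of_nonneg_left hs2 (show 0 ≤ 2 * r ^ 2 by positivity)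
  have h4 : 0 ≤ r ^ 2 * (v ⬝ᵥ v) := by positivity
  nlinarith

end Angle

/-! ### Cost of changing one coordinate -/

theorem scoreMat_of_lt {K : ℕ} (C : ℝ) (k : Fin K) {N i : ℕ} (u : ℕ → ℝ) (hi : i < N) :
    scoreMat C k N u i = Pi.single k (u i) := if_pos hi

theorem loadMat_apply {K : ℕ} (Q : ℕ → Fin K → Bool) (C : ℝ) (k : Fin K) {J j : ℕ} (w : ℕ → ℝ)
    (hj : j < J) : loadMat Q C k J w j k = if Q j k = true then w j else 0 := by
  rw [loadMat, if_pos hj]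
  split_ifs <;> simp

/-- The budget `9 * C ^ 2 * κ ^ 2` comes from a coordinate moving by at most `3 * δ`, multiplied by
entries at most `C`, over `m` observations with `δ ^ 2 * m = κ ^ 2`. The bound `κ ≤ C / 6` keeps the
levels within `[C / 2, C]`. -/
theorem exists_perturbation_scale (F : ExpFamily) (h : F.FullNaturalSpace) {C : ℝ} (hC : 0 < C) :
    ∃ κ : ℝ, 0 < κ ∧ κ ≤ C / 6 ∧ ∀ (K : ℕ) (Θ A Θ' A' : Matrix ℕ (Fin K) ℝ) (N J : ℕ),
      (∀ i < N, ∀ j < J, |A j ⬝ᵥ Θ i| ≤ C * C) → (∀ i < N, ∀ j < J, |A' j ⬝ᵥ Θ' i| ≤ C * C) →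
      ∑ i ∈ Finset.range N, ∑ j ∈ Finset.range J, (A' j ⬝ᵥ Θ' i - A j ⬝ᵥ Θ i) ^ 2
        ≤ 9 * C ^ 2 * κ ^ 2 →
      ∀ D, MeasurableSet D →
        (F.blockLaw h Θ' A' N J).real D ≤ (F.blockLaw h Θ A N J).real D + 1 / 8 := by
  obtain ⟨B, hB0, hB⟩ := ExpFamily.exists_blockLaw_le_add h (C * C)
  have hlog : 0 < Real.log (1 + (1 / 8 : ℝ) ^ 2) := Real.log_pos (by norm_num)
  set L := Real.log (1 + (1 / 8 : ℝ) ^ 2) with hL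
  refine ⟨min (C / 6) √(L / (B * (9 * C ^ 2))), lt_min (by positivity) (by positivity),
    min_le_left _ _, fun K Θ A Θ' A' N J hm hm' hsum D hD =>
      hB K Θ A Θ' A' N J hm hm' (1 / 8) (by norm_num) ?_ D hD⟩
  have h1 : min (C / 6) √(L / (B * (9 * C ^ 2))) ^ 2 ≤ L / (B * (9 * C ^ 2)) :=
    (pow_le_pow_left₀ (by positivity) (min_le_right _ _) 2).trans_eq
      (Real.sq_sqrt (by positivity))
  have h2 := hsum.trans (mul_le_mul_of_nonneg_left h1 (show 0 ≤ 9 * C ^ 2 by positivity))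
  refine (mul_le_mul_of_nonneg_left h2 hB0.le).trans_eq ?_
  rw [← hL]
  field_simp

variable {K : ℕ}

theorem score_diff_sum_le {C κ δ : ℝ} (k : Fin K) (A : Matrix ℕ (Fin K) ℝ)
    (N J : ℕ) (hA : ∀ j < J, |A j k| ≤ C) (hδ : δ ^ 2 * J ≤ κ ^ 2) (T : Finset (Fin N))
    (v v' : Fin N → Fin 4) (i : Fin N) (h : ∀ j, j ≠ i → v' j = v j) :
    ∑ i ∈ Finset.range N, ∑ j ∈ Finset.range J,
      (A j ⬝ᵥ scoreMat C k N (level T C δ v') i - A j ⬝ᵥ scoreMat C k N (level T C δ v) i) ^ 2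
      ≤ 9 * C ^ 2 * κ ^ 2 := by
  have e : ∀ i ∈ Finset.range N, ∑ j ∈ Finset.range J,
      (A j ⬝ᵥ scoreMat C k N (level T C δ v') i - A j ⬝ᵥ scoreMat C k N (level T C δ v) i) ^ 2
      ≤ (C ^ 2 * J) * (level T C δ v' i - level T C δ v i) ^ 2 := by
    intro i hi
    have hi' := Finset.mem_range.1 hi
    calc _ ≤ ∑ _j ∈ Finset.range J, C ^ 2 * (level T C δ v' i - level T C δ v i) ^ 2 := by
          refine Finset.sum_le_sum fun j hj => ?_
          rw [scoreMat_of_lt _ _ _ hi', scoreMat_of_lt _ _ _ hi', dotProduct_single,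
            dotProduct_single, ← mul_sub, mul_pow]
          have := hA j (Finset.mem_range.1 hj)
          exact mul_le_mul_of_nonneg_right (sq_le_sq' (neg_le_of_abs_le this)
            (le_of_abs_le this)) (sq_nonneg _)
      _ = _ := by rw [Finset.sum_const, Finset.card_range, nsmul_eq_mul]; ring
  refine (Finset.sum_le_sum e).trans ?_
  rw [← Finset.mul_sum]
  refine (mul_le_mul_of_nonneg_left (sum_sq_level_sub_le v v' i h) (by positivity)).trans ?_
  nlinarith [mul_le_mul_of_nonneg_left hδ (show 0 ≤ 9 * C ^ 2 by positivity)]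

theorem load_diff_sum_le {C κ δ : ℝ} (Q : ℕ → Fin K → Bool) (k : Fin K)
    (u : ℕ → ℝ) (N J : ℕ) (hu : ∀ i < N, |u i| ≤ C) (hδ : δ ^ 2 * N ≤ κ ^ 2)
    (T : Finset (Fin J)) (v v' : Fin J → Fin 4) (i : Fin J) (h : ∀ j, j ≠ i → v' j = v j) :
    ∑ i ∈ Finset.range N, ∑ j ∈ Finset.range J,
      (loadMat Q C k J (level T C δ v') j ⬝ᵥ scoreMat C k N u i -
        loadMat Q C k J (level T C δ v) j ⬝ᵥ scoreMat C k N u i) ^ 2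
      ≤ 9 * C ^ 2 * κ ^ 2 := by
  rw [Finset.sum_comm]
  have e : ∀ j ∈ Finset.range J, ∑ i ∈ Finset.range N,
      (loadMat Q C k J (level T C δ v') j ⬝ᵥ scoreMat C k N u i -
        loadMat Q C k J (level T C δ v) j ⬝ᵥ scoreMat C k N u i) ^ 2
      ≤ (C ^ 2 * N) * (level T C δ v' j - level T C δ v j) ^ 2 := by
    intro j hj
    have hj' := Finset.mem_range.1 hj
    calc _ ≤ ∑ _i ∈ Finset.range N, C ^ 2 * (level T C δ v' j - level T C δ v j) ^ 2 := by
          refine Finset.sum_le_sum fun i hi => ?_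
          rw [scoreMat_of_lt _ _ _ (Finset.mem_range.1 hi), dotProduct_single,
            dotProduct_single, loadMat_apply _ _ _ _ hj', loadMat_apply _ _ _ _ hj']
          have h1 := hu i (Finset.mem_range.1 hi)
          have h2 : u i ^ 2 ≤ C ^ 2 := sq_le_sq' (neg_le_of_abs_le h1) (le_of_abs_le h1)
          split_ifs
          · rw [← sub_mul, mul_pow, mul_comm]
            exact mul_le_mul_of_nonneg_right h2 (sq_nonneg _)
          · rw [sub_self, zero_pow two_ne_zero]; positivity
      _ = _ := by rw [Finset.sum_const, Finset.card_range, nsmul_eq_mul]; ring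
  refine (Finset.sum_le_sum e).trans ?_
  rw [← Finset.mul_sum]
  refine (mul_le_mul_of_nonneg_left (sum_sq_level_sub_le v v' i h) (by positivity)).trans ?_
  nlinarith [mul_le_mul_of_nonneg_left hδ (show 0 ≤ 9 * C ^ 2 by positivity)]

theorem abs_dotProduct_scoreMat_le {C : ℝ} (k : Fin K) (a : Fin K → ℝ)
    (ha : |a k| ≤ C) {N i : ℕ} (hi : i < N) (u : ℕ → ℝ) (hu : ∀ i, |u i| ≤ C) :
    |a ⬝ᵥ scoreMat C k N u i| ≤ C * C := by
  rw [scoreMat_of_lt _ _ _ hi, dotProduct_single, abs_mul]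
  exact mul_le_mul ha (hu i) (abs_nonneg _) ((abs_nonneg _).trans ha)

/-! ### Frobenius loss and transfer to the data law -/

theorem measurable_frobNorm_sub {N J : ℕ} {f : (Fin N → Fin J → ℝ) → Fin N → Fin J → ℝ}
    (hf : Measurable f) (M : Matrix (Fin N) (Fin J) ℝ) :
    Measurable fun y => frobNorm (Matrix.of (f y) - M) := by
  unfold frobNorm
  simp only [Matrix.sub_apply, Matrix.of_apply]
  fun_prop

theorem frob_triangle {N J : ℕ} (W M M' : Matrix (Fin N) (Fin J) ℝ) {r : ℝ}
    (h : frobNorm (W - M) ≤ r) (h' : frobNorm (W - M') ≤ r) :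
    ∑ i, ∑ j, (M i j - M' i j) ^ 2 ≤ 4 * r ^ 2 := by
  have key : ∀ M, frobNorm (W - M) ≤ r → ∑ i, ∑ j, (W i j - M i j) ^ 2 ≤ r ^ 2 :=
    fun M h => (Real.sqrt_le_iff.1 h).2
  calc ∑ i, ∑ j, (M i j - M' i j) ^ 2
      ≤ ∑ i, ∑ j, (2 * (W i j - M i j) ^ 2 + 2 * (W i j - M' i j) ^ 2) := by
        refine Finset.sum_le_sum fun i _ => Finset.sum_le_sum fun j _ => ?_
        nlinarith [sq_nonneg ((W i j - M i j) + (W i j - M' i j))]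
    _ = 2 * (∑ i, ∑ j, (W i j - M i j) ^ 2) + 2 * ∑ i, ∑ j, (W i j - M' i j) ^ 2 := by
        simp_rw [Finset.sum_add_distrib, ← Finset.mul_sum]
    _ ≤ 4 * r ^ 2 := by linarith [key M h, key M' h']

/-- The normalized Frobenius loss below `ε / √(N ∧ J)` bounds the Frobenius loss. -/
theorem frob_le_of_normalized_lt {N J : ℕ} (hN : 0 < N) (hJ : 0 < J) {x ε : ℝ}
    (h : 1 / √((N : ℝ) * (J : ℝ)) * x < ε / √((min N J : ℕ) : ℝ)) :
    x ≤ ε * √((max N J : ℕ) : ℝ) := by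
  have hNJ : (0 : ℝ) < √((N : ℝ) * (J : ℝ)) := Real.sqrt_pos.2 (by positivity)
  have hmin : (0 : ℝ) < √((min N J : ℕ) : ℝ) :=
    Real.sqrt_pos.2 (by exact_mod_cast lt_min hN hJ)
  have e : √((N : ℝ) * (J : ℝ)) = √((min N J : ℕ) : ℝ) * √((max N J : ℕ) : ℝ) := by
    rw [← Real.sqrt_mul (by positivity)]
    congr 1
    exact_mod_cast (min_mul_max N J).symm
  rw [one_div_mul_eq_div, div_lt_div_iff₀ hNJ hmin, e] at h
  have : x * √((min N J : ℕ) : ℝ) < (ε * √((max N J : ℕ) : ℝ)) * √((min N J : ℕ) : ℝ) := by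
    linarith
  exact (lt_of_mul_lt_mul_right this hmin.le).le

theorem dataLaw_event_ge {F : ExpFamily} (h : F.FullNaturalSpace) {Θ A : Matrix ℕ (Fin K) ℝ}
    {N J : ℕ} {G : Set (Fin N → Fin J → ℝ)} (hG : MeasurableSet G)
    (hge : (1 / 2 : ℝ≥0∞) ≤ F.blockLaw h Θ A N J Gᶜ) {E : Set (ℕ × ℕ → ℝ)}
    (hE : ∀ Y, dataBlock N J Y ∉ G → Y ∈ E) : (1 / 2 : ℝ≥0∞) ≤ F.dataLaw h Θ A E := by
  rw [ExpFamily.blockLaw, Measure.map_apply (ExpFamily.measurable_dataBlock N J) hG.compl] at hge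
  exact hge.trans (measure_mono fun Y hY => hE Y hY)

theorem entry_sub_mul_transpose {N J : ℕ} (Θ A : Matrix ℕ (Fin K) ℝ) (i : Fin N) (j : Fin J) :
    (firstRows N Θ * (firstRows J A).transpose) i j = A j ⬝ᵥ Θ i := by
  rw [dotProduct_comm]; rfl

/-! ### The two lower bounds -/

theorem exists_matrix_risk_ge (F : ExpFamily) (hA2 : F.FullNaturalSpace)
    (Q : ℕ → Fin K → Bool) (hA1 : StableDesign Q) (C : ℝ) (hC : 0 < C) :
    ∃ ε₁ : ℝ, 0 < ε₁ ∧ ∃ N₀ J₀ : ℕ, 0 < N₀ ∧ 0 < J₀ ∧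
      ∀ N J : ℕ, N₀ ≤ N → J₀ ≤ J →
        ∀ Mbar : (Fin N → Fin J → ℝ) → (Fin N → Fin J → ℝ), Measurable Mbar →
          ∃ Θ A : Matrix ℕ (Fin K) ℝ, (Θ, A) ∈ SQ Q C ∧
            (1 / 2 : ENNReal) ≤ F.dataLaw hA2 Θ A
              {Y | 1 / √((N : ℝ) * (J : ℝ)) *
                  frobNorm (Matrix.of (Mbar (dataBlock N J Y)) -
                      firstRows N Θ * (firstRows J A).transpose)
                ≥ ε₁ / √((min N J : ℕ) : ℝ)} := by
  obtain ⟨κ, hκ0, hκC, hκ⟩ := exists_perturbation_scale F hA2 hC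
  obtain ⟨k, p, J₀, hp, hJ₀⟩ := exists_factor_frequent hA1
  have hε2 : (κ * C * √p / 12) ^ 2 = κ ^ 2 * C ^ 2 * p / 144 := by
    rw [div_pow, mul_pow, mul_pow, Real.sq_sqrt hp.le]; norm_num
  refine ⟨κ * C * √p / 12, by positivity, 1, J₀ + 1, one_pos, Nat.succ_pos _,
    fun N J hN hJ Mbar hMbar => ?_⟩
  have hN0 : (0 : ℝ) < N := by exact_mod_cast hN
  have hJ0 : (0 : ℝ) < J := by exact_mod_cast (by omega : 0 < J)
  have hN1 : (1 : ℝ) ≤ N := by exact_mod_cast hN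
  have hJ1 : (1 : ℝ) ≤ J := by exact_mod_cast (by omega : 1 ≤ J)
  have hcount := hJ₀ J (by omega)
  set S := (Finset.univ : Finset (Fin J)).filter fun j : Fin J => Q j k = true with hS
  have scale : ∀ m : ℝ, 1 ≤ m → 0 ≤ κ / √m ∧ κ / √m ≤ C / 6 ∧ (κ / √m) ^ 2 * m = κ ^ 2 := by
    intro m hm
    have : (1 : ℝ) ≤ √m := Real.one_le_sqrt.2 hm
    refine ⟨by positivity, (div_le_self hκ0.le this).trans hκC, ?_⟩
    rw [div_pow, Real.sq_sqrt (by linarith)]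
    field_simp
  have load_le : ∀ w : ℕ → ℝ, (∀ j, |w j| ≤ C) → ∀ j < J, |loadMat Q C k J w j k| ≤ C := by
    intro w hw j hj
    rw [loadMat_apply _ _ _ _ hj]
    split_ifs
    · exact hw j
    · simpa using hC.le
  have hconst : ∀ _i : ℕ, |C / 2| ≤ C := fun _ => by
    rw [abs_of_pos (by positivity)]; linarith
  -- The longer side varies: each of its coordinates enters at most `min N J` observed entries, so
  -- `δ` has the order `1 / √(min N J)` of the claimed rate.
  rcases le_total J N with hJN | hNJ
  · obtain ⟨hδ0, hδC, hδ⟩ := scale J hJ1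
    set δ := κ / √(J : ℝ)
    set A := loadMat Q C k J fun _ => C / 2
    set Θ : (Fin N → Fin 4) → Matrix ℕ (Fin K) ℝ := fun v =>
      scoreMat C k N (level Finset.univ C δ v)
    have hlev : ∀ v i, |level (Finset.univ : Finset (Fin N)) C δ v i| ≤ C :=
      abs_level_le hδ0 hδC
    have hAC : ∀ j < J, |A j k| ≤ C := load_le _ hconst
    have hA : ∀ j : Fin J, A j k = if Q j k = true then C / 2 else 0 := fun j =>
      loadMat_apply Q C k _ j.isLt
    have hΘ : ∀ v (i : Fin N), Θ v i = Pi.single k (level Finset.univ C δ v i) := fun v i =>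
      scoreMat_of_lt C k _ i.isLt
    have hbd : ∀ v, ∀ i < N, ∀ j < J, |A j ⬝ᵥ Θ v i| ≤ C * C := fun v i hi j hj =>
      abs_dotProduct_scoreMat_le k _ (hAC j hj) hi _ (hlev v)
    set G : (Fin N → Fin 4) → Set (Fin N → Fin J → ℝ) := fun v =>
      {y | 1 / √((N : ℝ) * (J : ℝ)) *
        frobNorm (Matrix.of (Mbar y) - firstRows N (Θ v) * (firstRows J A).transpose) <
          κ * C * √p / 12 / √((min N J : ℕ) : ℝ)}
    have hG : ∀ v, MeasurableSet (G v) := fun v =>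
      measurableSet_lt ((measurable_frobNorm_sub hMbar _).const_mul _) measurable_const
    have hAk : p * J * (C / 2) ^ 2 ≤ ∑ j : Fin J, A j k ^ 2 := by
      refine (mul_le_mul_of_nonneg_right hcount (by positivity)).trans_eq ?_
      rw [hS, Finset.card_filter, Nat.cast_sum, Finset.sum_mul]
      refine Finset.sum_congr rfl fun j _ => ?_
      rw [hA]
      split_ifs <;> simp
    obtain ⟨v, hv⟩ := exists_half_le_failure
      (fun v => F.blockLaw hA2 (Θ v) A N J) Finset.univ
      ⟨⟨0, hN⟩, Finset.mem_univ _⟩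
      (fun i _ v v' hvv' => hκ K _ _ _ _ N J (hbd v) (hbd v')
        (score_diff_sum_le k A N J hAC hδ.le _ v v' i hvv')) G hG (by
        intro v v' y hy hy'
        have h1 := frob_triangle _ _ _ (frob_le_of_normalized_lt hN (by omega) hy)
          (frob_le_of_normalized_lt hN (by omega) hy')
        rw [mul_pow, hε2, max_eq_left hJN, Real.sq_sqrt hN0.le] at h1
        -- The difference of the two means has rank at most one, so its squared norm factors. With
        -- the constant 12 in `ε₁`, comparison yields at most `N / 9` differing coordinates, below
        -- the allowed `N / 8`.
        have h2 : ∑ i : Fin N, ∑ j : Fin J,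
            ((firstRows N (Θ v) * (firstRows J A).transpose) i j -
              (firstRows N (Θ v') * (firstRows J A).transpose) i j) ^ 2 =
            (∑ i : Fin N, (level Finset.univ C δ v i - level Finset.univ C δ v' i) ^ 2) *
              ∑ j : Fin J, A j k ^ 2 := by
          rw [Finset.sum_mul_sum]
          refine Finset.sum_congr rfl fun i _ => Finset.sum_congr rfl fun j _ => ?_
          rw [entry_sub_mul_transpose, entry_sub_mul_transpose, hΘ, hΘ, dotProduct_single, dotProduct_single]
          ring
        rw [h2] at h1
        have h3 := mul_le_mul (card_mul_sq_le_sum Finset.univ C δ v v') hAk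
          (by positivity) (Finset.sum_nonneg fun i _ => sq_nonneg _)
        set n := (Finset.univ.filter fun i => v i ≠ v' i).card
        have h4 : (n : ℝ) * δ ^ 2 * (p * J * (C / 2) ^ 2) =
            (κ ^ 2 * C ^ 2 * p) * (n / 4) := by
          rw [← hδ]; ring
        have h5 : (κ ^ 2 * C ^ 2 * p) * ((n : ℝ) / 4) ≤ (κ ^ 2 * C ^ 2 * p) * (N / 36) := by
          rw [← h4]
          refine (h3.trans h1).trans_eq ?_
          ring
        have h6 := le_of_mul_le_mul_left h5 (by positivity)
        have h7 : (8 : ℝ) * n ≤ N := by linarith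
        rw [Finset.card_univ, Fintype.card_fin]
        exact_mod_cast h7)
    exact ⟨Θ v, A, ⟨scoreMat_mem hC k N _ (hlev v), loadMat_mem hA1 hC k J _ hconst⟩,
      dataLaw_event_ge hA2 (hG v) hv fun Y hY => by
        rw [Set.mem_ofPred_eq]; exact not_lt.1 hY⟩
  · obtain ⟨hδ0, hδC, hδ⟩ := scale N hN1
    set δ := κ / √(N : ℝ)
    set A : (Fin J → Fin 4) → Matrix ℕ (Fin K) ℝ := fun v => loadMat Q C k J (level S C δ v)
    set Θ := scoreMat C k N fun _ => C / 2
    have hlev : ∀ v i, |level S C δ v i| ≤ C := abs_level_le hδ0 hδC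
    have hA : ∀ v (j : Fin J), A v j k = if Q j k = true then level S C δ v j else 0 :=
      fun v j => loadMat_apply Q C k _ j.isLt
    have hΘ : ∀ i : Fin N, Θ i = Pi.single k (C / 2) := fun i => scoreMat_of_lt C k _ i.isLt
    have hbd : ∀ v, ∀ i < N, ∀ j < J, |A v j ⬝ᵥ Θ i| ≤ C * C := fun v i hi j hj =>
      abs_dotProduct_scoreMat_le k _ (load_le _ (hlev v) j hj) hi _ hconst
    set G : (Fin J → Fin 4) → Set (Fin N → Fin J → ℝ) := fun v =>
      {y | 1 / √((N : ℝ) * (J : ℝ)) *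
        frobNorm (Matrix.of (Mbar y) - firstRows N Θ * (firstRows J (A v)).transpose) <
          κ * C * √p / 12 / √((min N J : ℕ) : ℝ)}
    have hG : ∀ v, MeasurableSet (G v) := fun v =>
      measurableSet_lt ((measurable_frobNorm_sub hMbar _).const_mul _) measurable_const
    have hScard : (0 : ℝ) < S.card := lt_of_lt_of_le (by positivity) hcount
    obtain ⟨v, hv⟩ := exists_half_le_failure
      (fun v => F.blockLaw hA2 Θ (A v) N J) S
      (Finset.card_pos.1 (by exact_mod_cast hScard))
      (fun i _ v v' hvv' => hκ K _ _ _ _ N J (hbd v) (hbd v')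
        (load_diff_sum_le Q k _ N J (fun i _ => hconst i) hδ.le S v v' i hvv')) G hG (by
        intro v v' y hy hy'
        have h1 := frob_triangle _ _ _ (frob_le_of_normalized_lt hN (by omega) hy)
          (frob_le_of_normalized_lt hN (by omega) hy')
        rw [mul_pow, hε2, max_eq_right hNJ, Real.sq_sqrt hJ0.le] at h1
        -- Only items in `S` load on `k`. The comparison now gives at most `p * J / 9` differences,
        -- and `p * J ≤ S.card`.
        have h2 : (N * (C / 2) ^ 2) * ∑ j ∈ S, (level S C δ v j - level S C δ v' j) ^ 2 =
            ∑ i : Fin N, ∑ j : Fin J,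
            ((firstRows N Θ * (firstRows J (A v)).transpose) i j -
              (firstRows N Θ * (firstRows J (A v')).transpose) i j) ^ 2 := by
          have e : ∀ i : Fin N, ∑ j : Fin J,
              ((firstRows N Θ * (firstRows J (A v)).transpose) i j -
                (firstRows N Θ * (firstRows J (A v')).transpose) i j) ^ 2 =
              (C / 2) ^ 2 * ∑ j ∈ S, (level S C δ v j - level S C δ v' j) ^ 2 := by
            intro i
            rw [hS, Finset.sum_filter, Finset.mul_sum, ← hS]
            refine Finset.sum_congr rfl fun j _ => ?_
            rw [entry_sub_mul_transpose, entry_sub_mul_transpose, hΘ,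
              dotProduct_single, dotProduct_single, hA, hA]
            split_ifs
            · ring
            · simp
          rw [Finset.sum_congr rfl fun i _ => e i, Finset.sum_const, Finset.card_univ,
            Fintype.card_fin, nsmul_eq_mul, mul_assoc]
        rw [← h2] at h1
        have h3 := mul_le_mul_of_nonneg_left (card_mul_sq_le_sum S C δ v v')
          (show 0 ≤ (N : ℝ) * (C / 2) ^ 2 by positivity)
        set n := (S.filter fun i => v i ≠ v' i).card
        have h4 : (N : ℝ) * (C / 2) ^ 2 * (n * δ ^ 2) = (κ ^ 2 * C ^ 2) * (n / 4) := by
          rw [← hδ]; ring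
        have h5 : (κ ^ 2 * C ^ 2) * ((n : ℝ) / 4) ≤ (κ ^ 2 * C ^ 2) * (p * J / 36) := by
          rw [← h4]
          refine (h3.trans h1).trans_eq ?_
          ring
        have h6 := le_of_mul_le_mul_left h5 (by positivity)
        have h7 : (8 : ℝ) * n ≤ S.card := by linarith
        exact_mod_cast h7)
    exact ⟨Θ, A v, ⟨scoreMat_mem hC k N _ hconst, loadMat_mem hA1 hC k J _ (hlev v)⟩,
      dataLaw_event_ge hA2 (hG v) hv fun Y hY => by
        rw [Set.mem_ofPred_eq]; exact not_lt.1 hY⟩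

theorem exists_score_risk_ge (F : ExpFamily) (hA2 : F.FullNaturalSpace)
    (Q : ℕ → Fin K → Bool) (C : ℝ) (hC : 0 < C) (k : Fin K)
    (A : Matrix ℕ (Fin K) ℝ) (hA : A ∈ SQ2 Q C) :
    ∃ ε₂ : ℝ, 0 < ε₂ ∧ ∃ N₀ J₀ : ℕ, 0 < N₀ ∧ 0 < J₀ ∧
        ∀ N J : ℕ, N₀ ≤ N → J₀ ≤ J →
          ∀ Θbar : (Fin N → Fin J → ℝ) → (Fin N → ℝ), Measurable Θbar →
            ∃ Θ ∈ SQ1 K C,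
              (fun i : Fin N => Θ i k) ≠ 0 ∧
              (1 / 2 : ENNReal) ≤ F.dataLaw hA2 Θ A
                {Y | sinAngle (Θbar (dataBlock N J Y)) (fun i : Fin N => Θ i k)
                    ≥ ε₂ / √(J : ℝ)} := by
  obtain ⟨κ, hκ0, hκC, hκ⟩ := exists_perturbation_scale F hA2 hC
  -- `N ≥ 2` makes `T` nonempty. The factor 50 gives `δ² = 2500 C² r²`; against `n δ² ≤ 90 r² N C²`
  -- and `N ≤ 3 |T|` it leaves `n ≤ (270 / 2500) |T|`, below `|T| / 8`.
  refine ⟨κ / (50 * C), by positivity, 2, 1, two_pos, one_pos, fun N J hN hJ Θbar hΘbar => ?_⟩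
  have hN0 : (0 : ℝ) < N := by exact_mod_cast (by omega : 0 < N)
  have hJ0 : (0 : ℝ) < J := by exact_mod_cast hJ
  have hsJ : (1 : ℝ) ≤ √(J : ℝ) := Real.one_le_sqrt.2 (by exact_mod_cast hJ)
  have hδ0 : 0 ≤ κ / √(J : ℝ) := by positivity
  have hδC : κ / √(J : ℝ) ≤ C / 6 := (div_le_self hκ0.le hsJ).trans hκC
  have hδ : (κ / √(J : ℝ)) ^ 2 * J = κ ^ 2 := by
    rw [div_pow, Real.sq_sqrt hJ0.le]; field_simp
  set r := κ / (50 * C) / √(J : ℝ) with hr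
  have hr0 : 0 < r := by positivity
  have hrδ : r ^ 2 * (2500 * C ^ 2) = (κ / √(J : ℝ)) ^ 2 := by
    rw [hr]; field_simp; norm_num
  have hr2 : r ≤ 1 / 2 := by
    refine (div_le_self (by positivity) hsJ).trans ?_
    rw [div_le_iff₀ (by positivity)]
    linarith
  set δ := κ / √(J : ℝ)
  set T := (Finset.univ : Finset (Fin N)).filter fun i : Fin N => (i : ℕ) < N / 2 with hT
  have hTcard : T.card = N / 2 := by
    rw [hT, Fin.card_filter_val_lt]
    omega
  have hTcard' : (N : ℝ) ≤ 3 * T.card := by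
    rw [hTcard]; exact_mod_cast (by omega : N ≤ 3 * (N / 2))
  have hTcompl : (N : ℝ) ≤ 2 * Tᶜ.card := by
    rw [Finset.card_compl, hTcard, Fintype.card_fin]
    exact_mod_cast (by omega : N ≤ 2 * (N - N / 2))
  have hAC : ∀ j < J, |A j k| ≤ C := fun j _ => (abs_entry_le_norm _ k).trans (hA.1 j)
  set u : (Fin N → Fin 4) → Fin N → ℝ := fun v i => level T C δ v i with hu
  have hlev : ∀ v i, |level T C δ v i| ≤ C := abs_level_le hδ0 hδC
  set Θ : (Fin N → Fin 4) → Matrix ℕ (Fin K) ℝ := fun v => scoreMat C k N (level T C δ v)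
  have hΘ : ∀ v, (fun i : Fin N => Θ v i k) = u v := by
    intro v
    funext i
    change scoreMat C k N (level T C δ v) i k = _
    rw [scoreMat_of_lt _ _ _ i.isLt, Pi.single_eq_same]
  have hbd : ∀ v, ∀ i < N, ∀ j < J, |A j ⬝ᵥ Θ v i| ≤ C * C := fun v i hi j hj =>
    abs_dotProduct_scoreMat_le k _ (hAC j hj) hi _ (hlev v)
  set G : (Fin N → Fin 4) → Set (Fin N → Fin J → ℝ) := fun v =>
    {y | sinAngle (Θbar y) (u v) < r}
  have hG : ∀ v, MeasurableSet (G v) := fun v =>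
    measurableSet_lt ((measurable_sinAngle _).comp hΘbar) measurable_const
  have husum : ∀ v, ∑ i, u v i ^ 2 ≤ N * C ^ 2 := by
    intro v
    calc ∑ i, u v i ^ 2 ≤ ∑ _i : Fin N, C ^ 2 := by
          refine Finset.sum_le_sum fun i _ => ?_
          have := hlev v i
          exact sq_le_sq' (neg_le_of_abs_le this) (le_of_abs_le this)
      _ = _ := by rw [Finset.sum_const, Finset.card_univ, Fintype.card_fin, nsmul_eq_mul]
  obtain ⟨v, hv⟩ := exists_half_le_failure
    (fun v => F.blockLaw hA2 (Θ v) A N J) T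
    (Finset.card_pos.1 (by omega))
    (fun i _ v v' hvv' => hκ K _ _ _ _ N J (hbd v) (hbd v')
      (score_diff_sum_le k A N J hAC hδ.le T v v' i hvv')) G hG (by
      intro v v' y hy hy'
      obtain ⟨s, hs⟩ := exists_sum_sq_sub_smul_le _ _ _ hr0 hr2 hy hy'
      have h1 : ∑ i, (u v i - s * u v' i) ^ 2 ≤ 5 * r ^ 2 * (N * C ^ 2) :=
        hs.trans (mul_le_mul_of_nonneg_left (husum v) (by positivity))
      -- Outside `T` both vectors equal `C / 2`, so near collinearity forces the factor `s` to be
      -- close to 1.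
      have h2 : (N : ℝ) * C ^ 2 * ((1 - s) ^ 2 / 8) ≤ ∑ i, (u v i - s * u v' i) ^ 2 := by
        calc (N : ℝ) * C ^ 2 * ((1 - s) ^ 2 / 8)
            ≤ (2 * Tᶜ.card) * C ^ 2 * ((1 - s) ^ 2 / 8) := by gcongr
          _ = ∑ i ∈ Tᶜ, (u v i - s * u v' i) ^ 2 := by
              rw [Finset.sum_congr rfl (g := fun _ => (C / 2 * (1 - s)) ^ 2),
                Finset.sum_const, nsmul_eq_mul]
              · ring
              · intro i hi
                rw [hu]
                simp only
                rw [level_of_notMem _ (Finset.mem_compl.1 hi),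
                  level_of_notMem _ (Finset.mem_compl.1 hi)]
                ring
          _ ≤ _ := Finset.sum_le_sum_of_subset_of_nonneg (Finset.subset_univ _)
              fun _ _ _ => sq_nonneg _
      have h3 : (1 - s) ^ 2 ≤ 40 * r ^ 2 := by
        have h4 : ((N : ℝ) * C ^ 2) * ((1 - s) ^ 2 / 8) ≤ ((N : ℝ) * C ^ 2) * (5 * r ^ 2) :=
          (h2.trans h1).trans_eq (by ring)
        have := le_of_mul_le_mul_left h4 (by positivity)
        linarith
      -- Replacing `s` by 1 costs `(1 - s) ^ 2 ≤ 40 r²` times the squared norm; the total constant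
      -- is `2 * 5 + 2 * 40 = 90`.
      have h5 : ∑ i, (u v i - u v' i) ^ 2 ≤
          2 * (∑ i, (u v i - s * u v' i) ^ 2) + 2 * (1 - s) ^ 2 * ∑ i, u v' i ^ 2 := by
        rw [Finset.mul_sum, Finset.mul_sum, ← Finset.sum_add_distrib]
        refine Finset.sum_le_sum fun i _ => ?_
        nlinarith [sq_nonneg ((u v i - s * u v' i) + (1 - s) * u v' i)]
      have h6 : (1 - s) ^ 2 * ∑ i, u v' i ^ 2 ≤ 40 * r ^ 2 * (N * C ^ 2) :=
        mul_le_mul h3 (husum v') (Finset.sum_nonneg fun _ _ => sq_nonneg _) (by positivity)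
      have h7 : ∑ i ∈ T, (u v i - u v' i) ^ 2 ≤ ∑ i, (u v i - u v' i) ^ 2 :=
        Finset.sum_le_sum_of_subset_of_nonneg (Finset.subset_univ _) fun _ _ _ => sq_nonneg _
      have h8 := card_mul_sq_le_sum T C δ v v'
      set n := (T.filter fun i => v i ≠ v' i).card
      have h9 : (n : ℝ) * δ ^ 2 ≤ 90 * r ^ 2 * (N * C ^ 2) := by
        refine (h8.trans h7).trans (h5.trans ?_)
        linarith
      have h10 : (r ^ 2 * C ^ 2) * (2500 * (n : ℝ)) ≤ (r ^ 2 * C ^ 2) * (90 * N) := by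
        rw [← hrδ] at h9
        linarith
      have h11 := le_of_mul_le_mul_left h10 (by positivity)
      have h12 : (8 : ℝ) * n ≤ T.card := by linarith
      exact_mod_cast h12)
  refine ⟨Θ v, scoreMat_mem hC k N _ (hlev v), ?_,
    dataLaw_event_ge hA2 (hG v) hv fun Y hY => ?_⟩
  · rw [hΘ]
    intro h0
    have h1 := congrFun h0 ⟨0, by omega⟩
    have h2 := (level_bounds (T := T) hδ0 hδC v 0).1
    have h3 : level T C δ v 0 = 0 := h1
    linarith
  · rw [Set.mem_ofPred_eq, hΘ]
    exact not_lt.1 hY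

end LatentFactor

end

theorem theorem3 (F : LatentFactor.ExpFamily) (hA2 : F.FullNaturalSpace)
    {K : ℕ} (Q : ℕ → Fin K → Bool) (hA1 : LatentFactor.StableDesign Q)
    (C : ℝ) (hC : 0 < C) :
    (∃ ε₁ : ℝ, 0 < ε₁ ∧ ∃ N₀ J₀ : ℕ, 0 < N₀ ∧ 0 < J₀ ∧
      ∀ N J : ℕ, N₀ ≤ N → J₀ ≤ J →
        ∀ Mbar : (Fin N → Fin J → ℝ) → (Fin N → Fin J → ℝ), Measurable Mbar →
          ∃ Θ A : Matrix ℕ (Fin K) ℝ, (Θ, A) ∈ LatentFactor.SQ Q C ∧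
            (1 / 2 : ENNReal) ≤ F.dataLaw hA2 Θ A
              {Y | 1 / √((N : ℝ) * (J : ℝ)) *
                  LatentFactor.frobNorm
                    (Matrix.of (Mbar (LatentFactor.dataBlock N J Y)) -
                      LatentFactor.firstRows N Θ *
                        (LatentFactor.firstRows J A).transpose)
                ≥ ε₁ / √((min N J : ℕ) : ℝ)}) ∧
    (∀ k : Fin K, ∀ A ∈ LatentFactor.SQ2 Q C,
      ∃ ε₂ : ℝ, 0 < ε₂ ∧ ∃ N₀ J₀ : ℕ, 0 < N₀ ∧ 0 < J₀ ∧
        ∀ N J : ℕ, N₀ ≤ N → J₀ ≤ J →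
          ∀ Θbar : (Fin N → Fin J → ℝ) → (Fin N → ℝ), Measurable Θbar →
            ∃ Θ ∈ LatentFactor.SQ1 K C,
              (fun i : Fin N => Θ i k) ≠ 0 ∧
              (1 / 2 : ENNReal) ≤ F.dataLaw hA2 Θ A
                {Y | LatentFactor.sinAngle (Θbar (LatentFactor.dataBlock N J Y))
                      (fun i : Fin N => Θ i k)
                    ≥ ε₂ / √(J : ℝ)}) := by
  exact ⟨LatentFactor.exists_matrix_risk_ge F hA2 Q hA1 C hC, fun k A hA =>
    LatentFactor.exists_score_risk_ge F hA2 Q C hC k A hA⟩
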